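/- **Conventions.** Cardinals are extended by a symbol $\infty$ with $\kappa<\infty$ for every cardinal $\kappa$, and $\min\emptyset=\infty$. Write $\omega=\{0,1,2,\dots\}$. An ideal on a set $X$ is a family of subsets of $X$ that is closed under finite unions and subsets, contains all finite subsets of $X$ and does not contain $X$. For an ideal $\mathcal I$ on a countably infinite set $X$ let $\widehat{\mathcal P}_{\mathcal I}$ be the set of sequences $(A_n)_{n\in\omega}$ of pairwise disjoint members of $\mathcal I$, $\mathcal P_{\mathcal I}$ the set of those $(A_n)\in\widehat{\mathcal P}_{\mathcal I}$ with $\bigcup_n A_n=X$, and $\mathcal M_{\mathcal I}$ the set of sequences $(E_n)_{n\in\omega}$ in $\mathcal I$ with $E_n\subseteq E_{n+1}$ for all $n$. Define $$\mathfrak b_s(\mathcal I)=\min\Big\{|\mathcal E|:\mathcal E\subseteq\widehat{\mathcal P}_{\mathcal I},\ \forall (A_n)\in\mathcal P_{\mathcal I}\ \exists (E_n)\in\mathcal E\ \ \bigcup_{n\in\omega}\Big(A_{n+1}\cap\bigcup_{i\le n}E_i\Big)\notin\mathcal I\Big\},$$ $$\mathfrak b_\sigma(\mathcal I)=\min\{|\mathcal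 E|:\mathcal E\subseteq\mathcal M_{\mathcal I},\ \forall (A_n)\in\mathcal M_{\mathcal I}\ \exists (E_n)\in\mathcal E\ \ E_n\not\subseteq A_n\text{ for infinitely many }n\},$$ $$\mathrm{add}_\omega(\mathcal I)=\min\{|\mathcal A|:\mathcal A\subseteq\mathcal I,\ \forall (B_n)\in\mathcal I^{\omega}\ \exists A\in\mathcal A\ \forall n\ \ A\not\subseteq B_n\}.$$ Let $\mathfrak b$ be the least size of a family $\mathcal F\subseteq\omega^\omega$ for which there is no $g\in\omega^\omega$ such that every $f\in\mathcal F$ satisfies $f(n)\le g(n)$ for all but finitely many $n$. Let $\mathcal N$ be the family of Lebesgue null subsets of $\mathbb R$ and $\mathrm{add}(\mathcal N)=\min\{|\mathcal A|:\mathcal A\subseteq\mathcal N,\ \bigcup\mathcal A\notin\mathcal N\}$. **Ideals.** For $A\subseteq X\times Y$ let $(A)_x=\{y:(x,y)\in A\}$. - $\mathrm{Fin}$ is the ideal of finite subsets of $\omega$. - On $\omega\times\omega$: $\mathrm{Fin}\otimes\{\emptyset\}=\{A:\{x:(A)_x\neq\emptyset\}\text{ is finite}\}$, $\{\emptyset\}\otimes\mathrm{Fin}=\{A:(A)_x\text{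 is finite for all }x\}$, $\mathrm{Fin}\otimes\mathrm{Fin}=\{A:\{x:(A)_x\text{ is infinite}\}\text{ is finite}\}$. - $\mathcal I_d=\{A\subseteq\omega:\lim_{n\to\infty}|A\cap\{0,\dots,n-1\}|/(n+1)=0\}$ and $\mathcal I_{1/n}=\{A\subseteq\omega:\sum_{n\in A}\frac1{n+1}<\infty\}$. - Let $\Omega$ be the (countable) set of clopen subsets of the Cantor space $2^\omega$ of Lebesgue (product) measure $1/2$. Solecki's ideal $\mathcal S$ consists of the subsets of $\Omega$ that are covered by finitely many sets of the form $G_x=\{U\in\Omega:x\in U\}$ with $x\in 2^\omega$. **Theorem.** 1. $\mathfrak b_\sigma(\mathrm{Fin})=\mathfrak b_s(\mathrm{Fin})=\mathfrak b<\infty=\mathrm{add}_\omega(\mathrm{Fin})$. 2. $\mathfrak b_\sigma(\mathrm{Fin}\otimes\{\emptyset\})=\mathfrak b_s(\mathrm{Fin}\otimes\{\emptyset\})=\mathfrak b<\infty=\mathrm{add}_\omega(\mathrm{Fin}\otimes\{\emptyset\})$. 3. $\mathfrak b_\sigma(\mathcal I_d)=\mathrm{add}_\omega(\mathcal I_d)=\mathrm{add}(\mathcal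 N)\le\mathfrak b=\mathfrak b_s(\mathcal I_d)$. 4. $\mathfrak b_\sigma(\mathcal I_{1/n})=\mathrm{add}_\omega(\mathcal I_{1/n})=\mathrm{add}(\mathcal N)\le\mathfrak b=\mathfrak b_s(\mathcal I_{1/n})$. 5. $\mathfrak b_\sigma(\mathrm{Fin}\otimes\mathrm{Fin})=\mathfrak b_s(\mathrm{Fin}\otimes\mathrm{Fin})=\mathrm{add}_\omega(\mathrm{Fin}\otimes\mathrm{Fin})=\mathfrak b$. 6. $\mathfrak b_\sigma(\{\emptyset\}\otimes\mathrm{Fin})=\mathfrak b_s(\{\emptyset\}\otimes\mathrm{Fin})=\mathrm{add}_\omega(\{\emptyset\}\otimes\mathrm{Fin})=\mathfrak b$. 7. $\mathfrak b_\sigma(\mathcal S)=\mathfrak b_s(\mathcal S)=\mathrm{add}_\omega(\mathcal S)=\omega_1$. -/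

import Mathlib

open Set Filter Topology MeasureTheory
open scoped Cardinal

namespace IdealNumbers

/-- `min {|E| : P E}` over all `E ⊆ α`, as an element of the cardinals together with a largest
element `⊤` (the paper's `∞`); the minimum of the empty family is `⊤`. -/
noncomputable def minCard {α : Type} (P : Set α → Prop) : WithTop Cardinal.{0} :=
  sInf ((fun E : Set α => ((#E : Cardinal.{0}) : WithTop Cardinal.{0})) '' {E | P E})

section Families

variable {X : Type}

/-- Sequences of pairwise disjoint members of `I`. -/
def DisjSeq (I : Set (Set X)) : Set (ℕ → Set X) :=
  {A | (∀ n, A n ∈ I) ∧ ∀ n k, n ≠ k → A n ∩ A k = ∅}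

/-- Sequences of pairwise disjoint members of `I` which cover the whole set. -/
def PartSeq (I : Set (Set X)) : Set (ℕ → Set X) :=
  {A | A ∈ DisjSeq I ∧ ⋃ n, A n = univ}

/-- Increasing sequences of members of `I`. -/
def MonoSeq (I : Set (Set X)) : Set (ℕ → Set X) :=
  {E | (∀ k, E k ∈ I) ∧ ∀ k, E k ⊆ E (k + 1)}

/-- The number `b_s(I, J, K)`. -/
noncomputable def bS₃ (I J K : Set (Set X)) : WithTop Cardinal.{0} :=
  minCard fun 𝓔 : Set (ℕ → Set X) =>
    𝓔 ⊆ DisjSeq K ∧ ∀ A ∈ PartSeq J, ∃ E ∈ 𝓔, (⋃ n, A (n + 1) ∩ ⋃ i ≤ n, E i) ∉ I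

/-- The number `b_σ(I, J)`. -/
noncomputable def bSigma₂ (I J : Set (Set X)) : WithTop Cardinal.{0} :=
  minCard fun 𝓔 : Set (ℕ → Set X) =>
    𝓔 ⊆ MonoSeq I ∧ ∀ A ∈ MonoSeq J, ∃ E ∈ 𝓔, ∃ᶠ n in atTop, ¬ E n ⊆ A n

/-- The number `add_ω(I, J)`. -/
noncomputable def addOmega₂ (I J : Set (Set X)) : WithTop Cardinal.{0} :=
  minCard fun 𝓐 : Set (Set X) =>
    𝓐 ⊆ I ∧ ∀ B : ℕ → Set X, (∀ n, B n ∈ J) → ∃ A ∈ 𝓐, ∀ n, ¬ A ⊆ B n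

/-- `b_s(I) = b_s(I, I, I)`. -/
noncomputable def bS (I : Set (Set X)) : WithTop Cardinal.{0} := bS₃ I I I

/-- `b_σ(I) = b_σ(I, I)`. -/
noncomputable def bSigma (I : Set (Set X)) : WithTop Cardinal.{0} := bSigma₂ I I

/-- `add_ω(I) = add_ω(I, I)`. -/
noncomputable def addOmega (I : Set (Set X)) : WithTop Cardinal.{0} := addOmega₂ I I

end Families

/-- The bounding number `𝔟`. -/
noncomputable def bNumber : WithTop Cardinal.{0} :=
  minCard fun F : Set (ℕ → ℕ) => ¬ ∃ g : ℕ → ℕ, ∀ f ∈ F, ∀ᶠ n in atTop, f n ≤ g n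

/-- The additivity of the ideal of Lebesgue null subsets of `ℝ`. -/
noncomputable def addNull : WithTop Cardinal.{0} :=
  minCard fun 𝓐 : Set (Set ℝ) => (∀ A ∈ 𝓐, volume A = 0) ∧ volume (⋃₀ 𝓐) ≠ 0

/-- The ideal of finite subsets of `ℕ`. -/
def FIN : Set (Set ℕ) := {A | A.Finite}

/-- The vertical section of `A` at `x`. -/
def vsection {X Y : Type} (A : Set (X × Y)) (x : X) : Set Y := {y | (x, y) ∈ A}

/-- The Fubini product `I ⊗ J`. -/
def fubini {X Y : Type} (I : Set (Set X)) (J : Set (Set Y)) : Set (Set (X × Y)) :=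
  {A | {x | vsection A x ∉ J} ∈ I}

/-- The ideal `I ⊗ {∅}`. -/
def fubiniEmptyRight {X : Type} (I : Set (Set X)) : Set (Set (X × ℕ)) :=
  {A | {x | vsection A x ≠ ∅} ∈ I}

/-- The ideal `{∅} ⊗ J`. -/
def fubiniEmptyLeft {Y : Type} (J : Set (Set Y)) : Set (Set (ℕ × Y)) :=
  {A | ∀ x, vsection A x ∈ J}

/-- The ideal of subsets of `ℕ` of asymptotic density zero. -/
def densityIdeal : Set (Set ℕ) :=
  {A | Tendsto (fun n : ℕ => ((A ∩ Iio n).ncard : ℝ) / ((n : ℝ) + 1)) atTop (𝓝 0)}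

/-- The summable ideal. -/
def summableIdeal : Set (Set ℕ) :=
  {A | Summable fun n : A => 1 / (((n : ℕ) : ℝ) + 1)}

/-- The Lebesgue (fair coin-tossing) measure on the Cantor space `2^ω`. -/
noncomputable def cantorMeasure : Measure (ℕ → Bool) :=
  Measure.infinitePi fun _ : ℕ => (PMF.uniformOfFintype Bool).toMeasure

/-- The countable set `Ω` of all clopen subsets of the Cantor space of measure `1/2`. -/
abbrev HalfClopen : Type :=
  {U : Set (ℕ → Bool) // IsClopen U ∧ cantorMeasure U = 1 / 2}

/-- Solecki's ideal on `Ω`: the sets covered by finitely many sets `{U ∈ Ω : x ∈ U}`. -/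
def soleckiIdeal : Set (Set HalfClopen) :=
  {𝓒 | ∃ F : Set (ℕ → Bool), F.Finite ∧ 𝓒 ⊆ ⋃ x ∈ F, {U : HalfClopen | x ∈ U.1}}

end IdealNumbers

open IdealNumbers

/-!
All the cardinals involved are bounding numbers of relations (`boundingNumber`), and most of the
inequalities are Galois–Tukey connections between the relations.

For every ideal, `min (addOmega I) 𝔟 ≤ bSigma I ≤ bS I` and `bSigma I ≤ addOmega I`, the middle
inequality using that the underlying set is countable. All the ideals considered except Solecki's
satisfy a uniform form of meagreness, which yields `bS I ≤ 𝔟` (`IsIdeal.bS_le_bNumber`). It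
therefore suffices to compute `addOmega I`. It is `⊤` for the two countably generated ideals and
`𝔟` for `{∅} ⊗ Fin` and `Fin ⊗ Fin`, and in all four cases everything else collapses to `𝔟`.

The density ideal and the summable ideal are the exhaustive ideals `exh φ` of submeasures `φ` which
on each block `[2 ^ p, 2 ^ (p + 1))` are comparable with the proportion (`IsDyadic`). For such
ideals `bS = 𝔟`, and `addOmega` is the localization number, the least size of a family of functions
not captured by a single slalom. One inequality (`locNumber_le_addOmega_exh`) captures the pieces
into which a member of the ideal is cut. For the other (`IsDyadic.addOmega_le_locNumber`) the values
of a function are represented by independent subsets of dyadic blocks, since a set that contains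
many independent sets is large. The localization number is at most `add(𝓝)`, because a null set is
coded by a function whose values are differences of finite unions of basic sets. Conversely `add(𝓝)`
is at most `addOmega` of the summable ideal: a summable set `A` is sent to the points that lie in
infinitely many of the events `O n`, `n ∈ A`, where the `O n` are open and contain independent
events of probability `1 / (n + 1)`. The Baire category theorem in a compact set off a given null
set recovers countably many summable sets (`exists_summable_of_null`).

For Solecki's ideal all three numbers are at least `ℵ₁` as for every ideal. The upper bounds hold
because countably many members of the ideal involve only countably many points of the Cantor space,
while a finite set `H` and a point `x ∉ H` are separated by a clopen set of measure `1 / 2`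
(`exists_halfClopen`).
-/

namespace IdealNumbers

/-! ### Bounding numbers of relations -/

section Relations

variable {α β : Type}

theorem minCard_le {P : Set α → Prop} {E : Set α} (h : P E) :
    minCard P ≤ ((#E : Cardinal.{0}) : WithTop Cardinal.{0}) :=
  sInf_le ⟨E, h, rfl⟩

theorem le_minCard {P : Set α → Prop} {c : WithTop Cardinal.{0}}
    (h : ∀ E, P E → c ≤ ((#E : Cardinal.{0}) : WithTop Cardinal.{0})) : c ≤ minCard P :=
  le_sInf (by rintro _ ⟨E, hE, rfl⟩; exact h E hE)

/-- The bounding number of a relation `R` between `X` and `Y`: the least size of a subset of `X`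
that is not `R`-bounded by a single element of `Y`. -/
noncomputable def boundingNumber (X : Set α) (R : α → β → Prop) (Y : Set β) :
    WithTop Cardinal.{0} :=
  minCard fun E : Set α => E ⊆ X ∧ ∀ y ∈ Y, ∃ x ∈ E, ¬ R x y

variable {X : Set α} {R : α → β → Prop} {Y : Set β} {c : WithTop Cardinal.{0}}

theorem exists_bound {ι : Type} (f : ι → α) (hf : ∀ i, f i ∈ X)
    (hι : ((#ι : Cardinal.{0}) : WithTop Cardinal.{0}) < boundingNumber X R Y) :
    ∃ y ∈ Y, ∀ i, R (f i) y := by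
  by_contra! h
  refine absurd hι (not_lt.2 ((minCard_le (E := range f) ?_).trans ?_))
  · refine ⟨by rintro _ ⟨i, rfl⟩; exact hf i, fun y hy => ?_⟩
    obtain ⟨i, hi⟩ := h y hy
    exact ⟨f i, ⟨i, rfl⟩, hi⟩
  · exact WithTop.coe_le_coe.2 Cardinal.mk_range_le

theorem le_boundingNumber
    (h : ∀ E ⊆ X, ((#E : Cardinal.{0}) : WithTop Cardinal.{0}) < c →
      ∃ y ∈ Y, ∀ x ∈ E, R x y) : c ≤ boundingNumber X R Y := by
  refine le_minCard fun E hE => ?_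
  by_contra! hc
  obtain ⟨y, hy, hxy⟩ := h E hE.1 hc
  obtain ⟨x, hx, hn⟩ := hE.2 y hy
  exact hn (hxy x hx)

/-- A Galois–Tukey connection compares bounding numbers. -/
theorem boundingNumber_le_of_tukey {α' β' : Type} {X' : Set α'} {R' : α' → β' → Prop}
    {Y' : Set β'} (φ : α → α') (ψ : β' → β) (hφ : ∀ x ∈ X, φ x ∈ X') (hψ : ∀ y ∈ Y', ψ y ∈ Y)
    (h : ∀ x ∈ X, ∀ y ∈ Y', R' (φ x) y → R x (ψ y)) :
    boundingNumber X' R' Y' ≤ boundingNumber X R Y := by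
  refine le_boundingNumber fun E hE hc => ?_
  obtain ⟨y, hy, hxy⟩ := exists_bound (fun x : E => φ x) (fun x => hφ x (hE x.2)) hc
  exact ⟨ψ y, hψ y hy, fun x hx => h x (hE hx) y hy (hxy ⟨x, hx⟩)⟩

theorem aleph_one_le_boundingNumber
    (h : ∀ f : ℕ → α, (∀ n, f n ∈ X) → ∃ y ∈ Y, ∀ n, R (f n) y) (hY : Y.Nonempty) :
    ((ℵ₁ : Cardinal.{0}) : WithTop Cardinal.{0}) ≤ boundingNumber X R Y := by
  refine le_boundingNumber fun E hE hc => ?_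
  have hc' : E.Countable :=
    Cardinal.le_aleph0_iff_set_countable.1 (Cardinal.lt_aleph_one_iff.1 (WithTop.coe_lt_coe.1 hc))
  rcases E.eq_empty_or_nonempty with rfl | hne
  · obtain ⟨y, hy⟩ := hY
    exact ⟨y, hy, by simp⟩
  · obtain ⟨f, rfl⟩ := hc'.exists_eq_range hne
    obtain ⟨y, hy, hr⟩ := h f fun n => hE ⟨n, rfl⟩
    exact ⟨y, hy, by rintro _ ⟨n, rfl⟩; exact hr n⟩

theorem mk_prod_nat_lt {ι : Type} (hι : ((#ι : Cardinal.{0}) : WithTop Cardinal.{0}) < c)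
    (hc : ((ℵ₁ : Cardinal.{0}) : WithTop Cardinal.{0}) ≤ c) :
    ((#(ι × ℕ) : Cardinal.{0}) : WithTop Cardinal.{0}) < c := by
  induction c using WithTop.recTopCoe with
  | top => exact WithTop.coe_lt_top _
  | coe c =>
    rw [WithTop.coe_lt_coe] at hι ⊢
    rw [WithTop.coe_le_coe] at hc
    have h0 : ℵ₀ < c := Cardinal.aleph0_lt_aleph_one.trans_le hc
    rw [Cardinal.mk_prod, Cardinal.lift_id, Cardinal.lift_id]
    exact Cardinal.mul_lt_of_lt h0.le hι (by simpa using h0)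

end Relations

section Numbers

variable {X : Type} {I : Set (Set X)}

theorem bSigma_eq : bSigma I =
    boundingNumber (MonoSeq I) (fun E A => ∀ᶠ n in atTop, E n ⊆ A n) (MonoSeq I) := by
  simp only [bSigma, bSigma₂, boundingNumber, Filter.not_eventually]

theorem bS_eq : bS I = boundingNumber (DisjSeq I)
    (fun E A => (⋃ n, A (n + 1) ∩ ⋃ i ≤ n, E i) ∈ I) (PartSeq I) := rfl

theorem addOmega_eq : addOmega I =
    boundingNumber I (fun A B => ∃ n, A ⊆ B n) {B : ℕ → Set X | ∀ n, B n ∈ I} := by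
  simp only [addOmega, addOmega₂, boundingNumber, not_exists]
  rfl

theorem bNumber_eq : bNumber = boundingNumber univ
    (fun f g : ℕ → ℕ => ∀ᶠ n in atTop, f n ≤ g n) univ := by
  simp only [bNumber, boundingNumber, subset_univ, true_and, mem_univ, true_imp_iff]
  simp only [not_exists, not_forall, exists_prop]

theorem addNull_eq : addNull =
    boundingNumber {A : Set ℝ | volume A = 0} (fun A B => A ⊆ B) {B : Set ℝ | volume B = 0} := by
  unfold addNull boundingNumber
  congr 1
  ext 𝓐
  refine and_congr Iff.rfl ⟨fun h B hB => ?_, fun h h0 => ?_⟩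
  · by_contra! hs
    exact h (measure_mono_null (sUnion_subset hs) hB)
  · obtain ⟨A, hA, hn⟩ := h _ h0
    exact hn (subset_sUnion_of_mem hA)

end Numbers

/-! ### The three numbers of an arbitrary ideal -/

/-- Ideals on `X` containing the finite sets; properness is not required. -/
structure IsIdeal {X : Type} (I : Set (Set X)) : Prop where
  mono : ∀ {A B : Set X}, A ∈ I → B ⊆ A → B ∈ I
  union : ∀ {A B : Set X}, A ∈ I → B ∈ I → A ∪ B ∈ I
  finite : ∀ {A : Set X}, A.Finite → A ∈ I

namespace IsIdeal

variable {X : Type} {I : Set (Set X)}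

theorem biUnion_finset (hI : IsIdeal I) {ι : Type} (s : Finset ι) {A : ι → Set X}
    (h : ∀ i ∈ s, A i ∈ I) : (⋃ i ∈ s, A i) ∈ I := by
  classical
  induction s using Finset.induction_on with
  | empty => simpa using hI.finite finite_empty
  | insert a s _ ih =>
    rw [Finset.set_biUnion_insert]
    exact hI.union (h a (by simp)) (ih fun i hi => h i (by simp [hi]))

theorem biUnion_le (hI : IsIdeal I) {A : ℕ → Set X} (h : ∀ i, A i ∈ I) (n : ℕ) :
    (⋃ i ≤ n, A i) ∈ I := by
  simpa using hI.biUnion_finset (Finset.Iic n) (A := A) fun i _ => h i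

theorem biUnion_le_mem_monoSeq (hI : IsIdeal I) {A : ℕ → Set X} (h : ∀ i, A i ∈ I) :
    (fun n => ⋃ i ≤ n, A i) ∈ MonoSeq I :=
  ⟨fun n => hI.biUnion_le h n, fun n => biUnion_subset_biUnion_left fun i (hi : i ≤ n) =>
    show i ≤ n + 1 by omega⟩

theorem disjointed_mem_disjSeq (hI : IsIdeal I) {A : ℕ → Set X} (h : ∀ i, A i ∈ I) :
    disjointed A ∈ DisjSeq I :=
  ⟨fun n => hI.mono (h n) (disjointed_subset A n), fun _ _ hnk =>
    Set.disjoint_iff_inter_eq_empty.1 (disjoint_disjointed A hnk)⟩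

theorem biUnion_le_disjointed {A : ℕ → Set X} (hA : Monotone A) (n : ℕ) :
    ⋃ i ≤ n, disjointed A i = A n := by
  have h := DFunLike.congr_fun (partialSups_disjointed A) n
  rwa [hA.partialSups_eq, partialSups_eq_biSup] at h

theorem disjointed_add_one {A : ℕ → Set X} (hA : Monotone A) (n : ℕ) :
    disjointed A (n + 1) = A (n + 1) \ A n :=
  hA.disjointed_succ (not_isMax n)

theorem monotone_of_mem_monoSeq {A : ℕ → Set X} (h : A ∈ MonoSeq I) : Monotone A :=
  monotone_nat_of_le_succ h.2

theorem bSigma_le_addOmega : bSigma I ≤ addOmega I := by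
  rw [bSigma_eq, addOmega_eq]
  refine boundingNumber_le_of_tukey (fun A _ => A) id (fun A hA => ⟨fun _ => hA, fun _ => le_rfl⟩)
    (fun B hB => hB.1) fun A _ B _ h => h.exists

/-- From a sequence eventually above `⋃ i ≤ n, E i`, enlarged by the first points of `X`, the
successive differences form a partition of the kind required for `bS`. -/
theorem bSigma_le_bS [Countable X] (hI : IsIdeal I) : bSigma I ≤ bS I := by
  rw [bSigma_eq, bS_eq]
  obtain ⟨e, he⟩ := Countable.exists_injective_nat X
  let D : (ℕ → Set X) → ℕ → Set X := fun A n => A n ∪ {x | e x ≤ n}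
  have hD : ∀ A ∈ MonoSeq I, (∀ n, D A n ∈ I) ∧ Monotone (D A) := fun A hA =>
    ⟨fun n => hI.union (hA.1 n) (hI.finite ((finite_Iic n).preimage he.injOn)),
      monotone_nat_of_le_succ fun n => union_subset_union (hA.2 n)
        fun x (hx : e x ≤ n) => show e x ≤ n + 1 by omega⟩
  refine boundingNumber_le_of_tukey (fun E n => ⋃ i ≤ n, E i) (fun A => disjointed (D A))
    (fun E hE => hI.biUnion_le_mem_monoSeq hE.1)
    (fun A hA => ⟨hI.disjointed_mem_disjSeq (hD A hA).1, ?_⟩) fun E hE A hA h => ?_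
  · rw [iUnion_disjointed]
    exact eq_univ_of_forall fun x => mem_iUnion.2 ⟨e x, Or.inr (le_refl (e x))⟩
  · obtain ⟨N, hN⟩ := eventually_atTop.1 h
    refine hI.mono (hI.biUnion_le hE.1 N) (iUnion_subset fun n x hx => ?_)
    by_contra hxN
    have hn : N ≤ n := by
      by_contra! hlt
      refine hxN (biUnion_subset_biUnion_left (fun i (hi : i ≤ n) => ?_) hx.2)
      exact show i ≤ N by omega
    rw [disjointed_add_one (hD A hA).2] at hx
    exact hx.1.2 (Or.inl (hN n hn hx.2))

theorem aleph_one_le_addOmega (hI : IsIdeal I) :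
    ((ℵ₁ : Cardinal.{0}) : WithTop Cardinal.{0}) ≤ addOmega I := by
  rw [addOmega_eq]
  exact aleph_one_le_boundingNumber (fun f hf => ⟨f, hf, fun n => ⟨n, le_rfl⟩⟩)
    ⟨fun _ => ∅, fun _ => hI.finite finite_empty⟩

theorem aleph_one_le_bSigma (hI : IsIdeal I) :
    ((ℵ₁ : Cardinal.{0}) : WithTop Cardinal.{0}) ≤ bSigma I := by
  rw [bSigma_eq]
  refine aleph_one_le_boundingNumber (fun f hf => ?_)
    ⟨fun _ => ∅, fun _ => hI.finite finite_empty, fun _ => le_rfl⟩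
  refine ⟨fun n => ⋃ j ≤ n, f j n, ⟨fun n => hI.biUnion_le (fun j => (hf j).1 n) n, fun n => ?_⟩,
    fun j => ?_⟩
  · refine iUnion₂_subset fun j hj => ((hf j).2 n).trans ?_
    exact subset_biUnion_of_mem (u := fun j => f j (n + 1)) (show j ≤ n + 1 by omega)
  · filter_upwards [eventually_ge_atTop j] with n hn
    exact subset_biUnion_of_mem (u := fun j => f j n) hn

/-- Fewer than `addOmega I` increasing sequences have all their terms below the terms of a single
increasing sequence; the indices at which this happens are then dominated by a single function. -/
theorem min_le_bSigma (hI : IsIdeal I) : min (addOmega I) bNumber ≤ bSigma I := by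
  rw [bSigma_eq]
  refine le_boundingNumber fun 𝓔 h𝓔 hc => ?_
  obtain ⟨ha, hb⟩ := lt_min_iff.1 hc
  have ha' := mk_prod_nat_lt ha hI.aleph_one_le_addOmega
  rw [addOmega_eq] at ha'
  obtain ⟨B, hB, hEB⟩ := exists_bound (fun p : 𝓔 × ℕ => p.1.1 p.2)
    (fun p => (h𝓔 p.1.2).1 p.2) ha'
  choose k hk using hEB
  rw [bNumber_eq] at hb
  obtain ⟨g, -, hg⟩ := exists_bound (fun (E : 𝓔) n => k (E, n)) (fun _ => mem_univ _) hb
  have hm := hI.biUnion_le_mem_monoSeq hB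
  have hm' := monotone_of_mem_monoSeq hm
  -- partial sums of `g` make the resulting sequence of sets increasing
  refine ⟨fun n => ⋃ i ≤ ∑ j ∈ Finset.range (n + 1), g j, B i, ⟨fun n => hm.1 _, fun n => hm' ?_⟩,
    fun E hE => ?_⟩
  · rw [Finset.sum_range_succ _ (n + 1)]
    exact Nat.le_add_right _ _
  · filter_upwards [hg ⟨E, hE⟩] with n hn
    refine (hk (⟨E, hE⟩, n)).trans (subset_biUnion_of_mem (u := B) ?_)
    exact hn.trans (Finset.single_le_sum (f := g) (fun _ _ => Nat.zero_le _) (by simp))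

/-- A sufficient condition for `bS I ≤ 𝔟`: there are sets `J m ∈ I`, with a notion of smallness at
`m`, such that every member of `I` is small at almost all `m`, while two sets small at `m` never
cover `J m`. A function `f`, made monotone by taking partial sums, is sent to the disjoint sequence
whose terms with indices at most `n` have union `⋃ m ≤ f n, J m`. A partition `A` is sent to a
function `g` such that `⋃ i ≤ n, A i` is small at `g n`. -/
theorem bS_le_bNumber (hI : IsIdeal I) (J : ℕ → Set X) (hJ : ∀ m, J m ∈ I)
    (small : ℕ → Set X → Prop) (hs : ∀ A ∈ I, ∀ᶠ m in atTop, small m A)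
    (hcov : ∀ m A B, small m A → small m B → ¬ J m ⊆ A ∪ B) : bS I ≤ bNumber := by
  rw [bS_eq, bNumber_eq]
  let F : (ℕ → ℕ) → ℕ → Set X := fun f n => ⋃ m ≤ ∑ j ∈ Finset.range (n + 1), f j, J m
  have hm := hI.biUnion_le_mem_monoSeq hJ
  have hF : ∀ f, Monotone (F f) := fun f => monotone_nat_of_le_succ fun n =>
    monotone_of_mem_monoSeq hm (by
      rw [Finset.sum_range_succ _ (n + 1)]
      exact Nat.le_add_right _ _)
  have hg : ∀ A ∈ PartSeq I, ∃ g : ℕ → ℕ, ∀ n, n ≤ g n ∧ small (g n) (⋃ i ≤ n, A i) := by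
    intro A hA
    have : ∀ n, ∃ m, n ≤ m ∧ small m (⋃ i ≤ n, A i) := fun n =>
      ((eventually_ge_atTop n).and (hs _ (hI.biUnion_le hA.1.1 n))).exists
    exact ⟨fun n => (this n).choose, fun n => (this n).choose_spec⟩
  choose! g hg using hg
  refine boundingNumber_le_of_tukey (fun f => disjointed (F f)) g
    (fun f _ => hI.disjointed_mem_disjSeq fun n => hm.1 _) (fun _ _ => mem_univ _)
    fun f _ A hA hC => ?_
  simp only [biUnion_le_disjointed (hF f)] at hC
  -- if `g n < f n`, then `J (g n)` is covered by the union in `hC` and `⋃ i ≤ n, A i`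
  obtain ⟨N, hN⟩ := eventually_atTop.1 (hs _ hC)
  filter_upwards [eventually_ge_atTop N] with n hn
  by_contra! hlt
  obtain ⟨h1, h2⟩ := hg A hA n
  refine hcov (g A n) _ _ (hN _ (hn.trans h1)) h2 fun x hx => ?_
  have hxF : x ∈ F f n := by
    refine mem_biUnion (show g A n ≤ _ from ?_) hx
    exact hlt.le.trans (Finset.single_le_sum (f := f) (fun _ _ => Nat.zero_le _) (by simp))
  obtain ⟨j, hj⟩ := mem_iUnion.1 (hA.2 ▸ mem_univ x : x ∈ ⋃ n, A n)
  rcases le_or_gt j n with hjn | hjn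
  · exact Or.inr (mem_biUnion (show j ≤ n from hjn) hj)
  · obtain ⟨k, rfl⟩ : ∃ k, j = k + 1 := ⟨j - 1, by omega⟩
    exact Or.inl (mem_iUnion.2 ⟨k, hj, hF f (by omega) hxF⟩)

/-- A sufficient condition for `𝔟 ≤ bS I`, in which a sequence is treated by cutting `ℕ` into the
intervals determined by a fast growing function. -/
theorem bNumber_le_bS {I : Set (Set ℕ)} (hI : IsIdeal I)
    (h : ∀ F ∈ MonoSeq I, ∃ f : ℕ → ℕ, ∀ g : ℕ → ℕ, StrictMono g → (∀ᶠ n in atTop, f n ≤ g n) →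
      (⋃ n, F n \ Iio (g n)) ∈ I) : bNumber ≤ bS I := by
  rw [bS_eq, bNumber_eq]
  choose! φ hφ using h
  let G : (ℕ → ℕ) → ℕ → ℕ := fun g n => ∑ j ∈ Finset.range (n + 1), (g j + 1)
  have hG : ∀ g, StrictMono (G g) := fun g => strictMono_nat_of_lt_succ fun n => by
    simp only [G]
    rw [Finset.sum_range_succ _ (n + 1)]
    omega
  have hGg : ∀ g n, g n ≤ G g n := fun g n => (Nat.le_succ _).trans
    (Finset.single_le_sum (f := fun j => g j + 1) (fun _ _ => Nat.zero_le _) (by simp))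
  have hD : ∀ g, Monotone fun n => Iio (G g n) := fun g n m hnm =>
    Iio_subset_Iio ((hG g).monotone hnm)
  refine boundingNumber_le_of_tukey (fun E => φ fun n => ⋃ i ≤ n, E i)
    (fun g => disjointed fun n => Iio (G g n)) (fun _ _ => mem_univ _)
    (fun g _ => ⟨hI.disjointed_mem_disjSeq fun n => hI.finite (finite_Iio _), ?_⟩)
    fun E hE g _ hfg => ?_
  · rw [iUnion_disjointed]
    exact eq_univ_of_forall fun x => mem_iUnion.2 ⟨x + 1, ((hG g).id_le (x + 1) : x + 1 ≤ _)⟩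
  · refine hI.mono (hφ _ (hI.biUnion_le_mem_monoSeq hE.1) (G g) (hG g) ?_)
      (iUnion_mono fun n x hx => ?_)
    · filter_upwards [hfg] with n hn using hn.trans (hGg g n)
    · rw [disjointed_add_one (hD g)] at hx
      exact ⟨hx.2, hx.1.2⟩

end IsIdeal

theorem bNumber_lt_top : bNumber < ⊤ := by
  refine lt_of_le_of_lt (minCard_le (E := univ) ?_) (WithTop.coe_lt_top _)
  rintro ⟨g, hg⟩
  obtain ⟨n, hn⟩ := (hg (fun n => g n + 1) (mem_univ _)).exists
  omega

/-! ### Finite sets and Fubini products -/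

namespace IsIdeal

variable {X : Type} {I : Set (Set X)}

theorem addOmega_eq_top (B : ℕ → Set X) (hB : ∀ n, B n ∈ I) (h : ∀ A ∈ I, ∃ n, A ⊆ B n) :
    addOmega I = ⊤ := by
  rw [addOmega_eq]
  exact top_unique (le_boundingNumber fun E hE _ => ⟨B, hB, fun A hA => h A (hE hA)⟩)

theorem eq_bNumber_of_le [Countable X] (hI : IsIdeal I) (h : bNumber ≤ addOmega I)
    (hb : bS I ≤ bNumber) : bSigma I = bNumber ∧ bS I = bNumber := by
  have h1 : bNumber ≤ bSigma I := (le_min h le_rfl).trans hI.min_le_bSigma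
  exact ⟨(hI.bSigma_le_bS.trans hb).antisymm h1, hb.antisymm (h1.trans hI.bSigma_le_bS)⟩

/-- The case of `bS_le_bNumber` in which the sets `J m` are singletons. -/
theorem bS_le_bNumber_of_injective (hI : IsIdeal I) (p : ℕ → X)
    (h : ∀ A ∈ I, ∀ᶠ m in atTop, p m ∉ A) : bS I ≤ bNumber :=
  hI.bS_le_bNumber (fun m => {p m}) (fun _ => hI.finite (finite_singleton _))
    (fun m A => p m ∉ A) h fun _ _ _ hA hB hc => (hc (mem_singleton _)).elim hA hB

end IsIdeal

theorem isIdeal_FIN : IsIdeal FIN :=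
  ⟨fun hA hB => Set.Finite.subset hA hB, fun hA hB => Set.Finite.union hA hB, id⟩

theorem addOmega_FIN : addOmega FIN = ⊤ :=
  IsIdeal.addOmega_eq_top (fun n => Iic n) (fun n => finite_Iic n) fun _ hA =>
    (Set.Finite.bddAbove hA).imp fun _ hn _ hx => hn hx

theorem bS_FIN_le : bS FIN ≤ bNumber :=
  isIdeal_FIN.bS_le_bNumber_of_injective id fun A hA => by
    rw [← Nat.cofinite_eq_atTop]
    exact Set.Finite.eventually_cofinite_notMem hA

theorem isIdeal_fubiniEmptyRight : IsIdeal (fubiniEmptyRight FIN) where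
  mono hA hBA := Set.Finite.subset hA fun x hx h =>
    hx (subset_empty_iff.1 (h ▸ fun y hy => hBA hy))
  union hA hB := by
    refine Set.Finite.subset (Set.Finite.union hA hB) fun x hx => ?_
    obtain ⟨y, hy⟩ := nonempty_iff_ne_empty.2 hx
    exact hy.imp (fun h => nonempty_iff_ne_empty.1 ⟨y, h⟩) fun h => nonempty_iff_ne_empty.1 ⟨y, h⟩
  finite hA := by
    refine (hA.image Prod.fst).subset fun x hx => ?_
    obtain ⟨y, hy⟩ := nonempty_iff_ne_empty.2 hx
    exact ⟨(x, y), hy, rfl⟩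

theorem addOmega_fubiniEmptyRight : addOmega (fubiniEmptyRight FIN) = ⊤ := by
  refine IsIdeal.addOmega_eq_top (fun n => {p | p.1 ≤ n}) (fun n => ?_) fun A hA => ?_
  · refine (finite_Iic n).subset fun x hx => ?_
    obtain ⟨y, hy⟩ := nonempty_iff_ne_empty.2 hx
    exact hy
  · obtain ⟨n, hn⟩ := Set.Finite.bddAbove hA
    exact ⟨n, fun p hp => hn (nonempty_iff_ne_empty.1 ⟨p.2, hp⟩)⟩

theorem bS_fubiniEmptyRight_le : bS (fubiniEmptyRight FIN) ≤ bNumber :=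
  isIdeal_fubiniEmptyRight.bS_le_bNumber_of_injective (fun m => (m, 0)) fun A hA => by
    rw [← Nat.cofinite_eq_atTop]
    filter_upwards [Set.Finite.eventually_cofinite_notMem hA] with x hx h
    exact hx (nonempty_iff_ne_empty.1 ⟨0, h⟩)

theorem isIdeal_fubiniEmptyLeft : IsIdeal (fubiniEmptyLeft FIN) where
  mono hA hBA x := Set.Finite.subset (hA x) fun _ hy => hBA hy
  union hA hB x := Set.Finite.union (hA x) (hB x)
  finite hA x := hA.preimage (Prod.mk_right_injective x).injOn

/-- The set of points on or below the graph of `f`. -/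
def underGraph (f : ℕ → ℕ) : Set (ℕ × ℕ) := {p | p.2 ≤ f p.1}

theorem underGraph_mem (f : ℕ → ℕ) : underGraph f ∈ fubiniEmptyLeft FIN :=
  fun x => finite_Iic (f x)

theorem exists_le_of_mem_FIN (A : Set ℕ) : ∃ k, A ∈ FIN → ∀ y ∈ A, y ≤ k := by
  by_cases hA : A ∈ FIN
  · exact (Set.Finite.bddAbove hA).imp fun k hk _ y hy => hk hy
  · exact ⟨0, fun h => absurd h hA⟩

/-- A function bounding every finite vertical section of `A`. -/
noncomputable def sectionBound (A : Set (ℕ × ℕ)) (x : ℕ) : ℕ :=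
  (exists_le_of_mem_FIN (vsection A x)).choose

theorem le_sectionBound {A : Set (ℕ × ℕ)} {x y : ℕ} (hA : vsection A x ∈ FIN) (h : (x, y) ∈ A) :
    y ≤ sectionBound A x :=
  (exists_le_of_mem_FIN (vsection A x)).choose_spec hA y h

theorem fubiniEmptyLeft_subset_fubini : fubiniEmptyLeft FIN ⊆ fubini FIN FIN := fun _ hA =>
  Set.Finite.subset finite_empty fun x hx => hx (hA x)

theorem isIdeal_fubini : IsIdeal (fubini FIN FIN) where
  mono hA hBA := Set.Finite.subset hA fun x hx h => hx (Set.Finite.subset h fun _ hy => hBA hy)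
  union {A B} hA hB := by
    refine Set.Finite.subset (Set.Finite.union hA hB) fun x hx => ?_
    by_contra h
    exact hx (Set.Finite.union (by_contra fun h1 => h (Or.inl h1))
      (by_contra fun h2 => h (Or.inr h2)))
  finite hA := fubiniEmptyLeft_subset_fubini (isIdeal_fubiniEmptyLeft.finite hA)

/-- For an ideal between `{∅} ⊗ Fin` and `Fin ⊗ Fin`, countably many members give countably many
functions, and any function dominating all of these dominates whatever they bound. -/
theorem addOmega_le_bNumber {I : Set (Set (ℕ × ℕ))} (h1 : fubiniEmptyLeft FIN ⊆ I)
    (h2 : I ⊆ fubini FIN FIN) : addOmega I ≤ bNumber := by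
  rw [addOmega_eq, bNumber_eq]
  refine boundingNumber_le_of_tukey underGraph
    (fun B n => ∑ i ∈ Finset.range (n + 1), sectionBound (B i) n) (fun f _ => h1 (underGraph_mem f))
    (fun _ _ => mem_univ _) ?_
  rintro f - B hB ⟨i, hi⟩
  have hfin : {x | vsection (B i) x ∉ FIN}.Finite := h2 (hB i)
  have := hfin.eventually_cofinite_notMem
  rw [Nat.cofinite_eq_atTop] at this
  filter_upwards [this, eventually_ge_atTop i] with n hn hin
  refine (le_sectionBound (A := B i) (by_contra hn) (hi (le_refl (f n)))).trans ?_
  exact Finset.single_le_sum (f := fun i => sectionBound (B i) n) (fun _ _ => Nat.zero_le _)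
    (by simpa using Nat.lt_succ_of_le hin)

theorem bNumber_le_addOmega_fubiniEmptyLeft : bNumber ≤ addOmega (fubiniEmptyLeft FIN) := by
  rw [addOmega_eq, bNumber_eq]
  refine boundingNumber_le_of_tukey sectionBound (fun g n => underGraph fun x => max (g x) n)
    (fun _ _ => mem_univ _) (fun _ _ _ => underGraph_mem _) fun A hA g _ h => ?_
  obtain ⟨N, hN⟩ := eventually_atTop.1 h
  refine ⟨N + ∑ x ∈ Finset.range N, sectionBound A x, fun ⟨x, y⟩ hp => ?_⟩
  refine (le_sectionBound (hA x) hp).trans ?_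
  rcases lt_or_ge x N with hx | hx
  · exact le_max_of_le_right ((Finset.single_le_sum (f := sectionBound A)
      (fun _ _ => Nat.zero_le _) (by simpa using hx)).trans (Nat.le_add_left _ _))
  · exact le_max_of_le_left (hN x hx)

theorem bNumber_le_addOmega_fubini : bNumber ≤ addOmega (fubini FIN FIN) := by
  rw [addOmega_eq, bNumber_eq]
  refine boundingNumber_le_of_tukey sectionBound
    (fun g n => {p | p.1 < n} ∪ underGraph g)
    (fun _ _ => mem_univ _) (fun g _ n => isIdeal_fubini.union ?_
      (fubiniEmptyLeft_subset_fubini (underGraph_mem g))) fun A hA g _ h => ?_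
  · refine (finite_Iio n).subset fun x hx => ?_
    by_contra! hxn
    exact hx (Set.Finite.subset finite_empty fun y hy => hxn hy)
  · have hfin : {x | vsection A x ∉ FIN}.Finite := hA
    have := hfin.eventually_cofinite_notMem
    rw [Nat.cofinite_eq_atTop] at this
    obtain ⟨N, hN⟩ := eventually_atTop.1 (h.and this)
    refine ⟨N, fun ⟨x, y⟩ hp => ?_⟩
    rcases lt_or_ge x N with hx | hx
    · exact Or.inl hx
    · exact Or.inr ((le_sectionBound (by_contra (hN x hx).2) hp).trans (hN x hx).1)

theorem bS_fubiniEmptyLeft_le : bS (fubiniEmptyLeft FIN) ≤ bNumber :=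
  isIdeal_fubiniEmptyLeft.bS_le_bNumber_of_injective (fun m => (0, m)) fun A hA => by
    rw [← Nat.cofinite_eq_atTop]
    exact (Set.Finite.eventually_cofinite_notMem (hA 0) :)

theorem bS_fubini_le : bS (fubini FIN FIN) ≤ bNumber := by
  refine isIdeal_fubini.bS_le_bNumber (fun m => {p | p.1 = m}) (fun m => ?_)
    (fun m A => vsection A m ∈ FIN) (fun A hA => ?_) fun m A B hA hB hc => ?_
  · refine (finite_singleton m).subset fun x hx => ?_
    by_contra! hxn
    exact hx (Set.Finite.subset finite_empty fun y hy => hxn hy)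
  · have hfin : {x | vsection A x ∉ FIN}.Finite := hA
    have := hfin.eventually_cofinite_notMem
    rw [Nat.cofinite_eq_atTop] at this
    filter_upwards [this] with m hm using by_contra hm
  · refine infinite_univ (α := ℕ) ((Set.Finite.union hA hB).subset fun y _ => ?_)
    exact hc (show (m, y).1 = m from rfl)

/-! ### Solecki's ideal -/

instance : Countable HalfClopen := by
  have h : Countable (TopologicalSpace.Clopens (ℕ → Bool)) :=
    TopologicalSpace.Clopens.countable_iff_secondCountable.2 inferInstance
  refine Function.Injective.countable (β := TopologicalSpace.Clopens (ℕ → Bool))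
    (f := fun U : HalfClopen => ⟨U.1, U.2.1⟩) fun U V h => ?_
  exact Subtype.ext (congrArg (fun W : TopologicalSpace.Clopens (ℕ → Bool) => W.carrier) h)

/-- A clopen set determined by the first `N` coordinates has as measure its proportion. -/
theorem cantorMeasure_preimage (N : ℕ) (T : Finset (Finset.range N → Bool)) :
    cantorMeasure ((Finset.range N).restrict ⁻¹' (T : Set (Finset.range N → Bool))) =
      (T.card : ENNReal) / 2 ^ N := by
  have hm : Measurable ((Finset.range N).restrict : (ℕ → Bool) → (Finset.range N → Bool)) :=
    Finset.measurable_restrict _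
  rw [cantorMeasure, ← Measure.map_apply hm (T.finite_toSet.measurableSet),
    Measure.infinitePi_map_restrict, ← MeasureTheory.sum_measure_singleton]
  have : ∀ t : Finset.range N → Bool,
      (Measure.pi fun _ : Finset.range N => (PMF.uniformOfFintype Bool).toMeasure) {t} =
        (2 ^ N)⁻¹ := by
    intro t
    rw [Measure.pi_singleton]
    simp [ENNReal.inv_pow]
  simp [this, div_eq_mul_inv]

theorem exists_halfClopen {H : Set (ℕ → Bool)} (hH : H.Finite) {x : ℕ → Bool} (hx : x ∉ H) :
    ∃ U : HalfClopen, x ∈ U.1 ∧ ∀ y ∈ H, y ∉ U.1 := by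
  classical
  -- `k y` is a coordinate at which `x` and `y` differ
  have hk : ∀ y, ∃ k, y ∈ H → x k ≠ y k := fun y => by
    by_cases hy : y ∈ H
    · obtain ⟨k, hk⟩ := Function.ne_iff.1 (ne_of_mem_of_not_mem hy hx)
      exact ⟨k, fun _ => hk.symm⟩
    · exact ⟨0, fun h => absurd h hy⟩
  choose k hk using hk
  -- `M + 1` coordinates separate `x` from `H`, and `H` meets at most half of their `2 ^ (M + 1)`
  -- cylinders; the clopen set is a union of `2 ^ M` of the other cylinders
  let s := hH.toFinset
  obtain ⟨M, hM1, hM2⟩ : ∃ M, (∀ y ∈ s, k y ≤ M) ∧ s.card ≤ M :=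
    ⟨s.sup k + s.card, fun y hy => (Finset.le_sup hy).trans (by omega), by omega⟩
  let r : (ℕ → Bool) → (Finset.range (M + 1) → Bool) := (Finset.range (M + 1)).restrict
  have hrx : r x ∈ (s.image r)ᶜ := by
    simp only [Finset.mem_compl, Finset.mem_image, not_exists, not_and]
    intro y hy h
    refine hk y (hH.mem_toFinset.1 hy) ?_
    exact (congrFun h ⟨k y, by simpa using Nat.lt_succ_of_le (hM1 y hy)⟩).symm
  have hM : M < 2 ^ M := Nat.lt_two_pow_self
  have hcard : 2 ^ M ≤ (s.image r)ᶜ.card := by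
    rw [Finset.card_compl]
    have h1 : (s.image r).card ≤ s.card := Finset.card_image_le
    have h2 : Fintype.card (Finset.range (M + 1) → Bool) = 2 ^ (M + 1) := by simp
    rw [h2, pow_succ]
    omega
  obtain ⟨T, hT1, hT2, hT3⟩ := Finset.exists_subsuperset_card_eq
    (Finset.singleton_subset_iff.2 hrx) (by simpa using Nat.one_le_two_pow) hcard
  refine ⟨⟨r ⁻¹' (T : Set _), ?_, ?_⟩, ?_, fun y hy hyT => ?_⟩
  · exact (isClopen_discrete _).preimage (Finset.continuous_restrict _)
  · rw [cantorMeasure_preimage, hT3, pow_succ, Nat.cast_pow, Nat.cast_ofNat, one_div,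
      ENNReal.div_eq_inv_mul, ENNReal.mul_inv (by simp) (by simp), mul_comm, ← mul_assoc,
      ENNReal.mul_inv_cancel (by simp) (by simp), one_mul]
  · exact hT1 (Finset.mem_singleton_self _)
  · exact (Finset.mem_compl.1 (hT2 hyT)) (Finset.mem_image_of_mem r (hH.mem_toFinset.2 hy))

/-- The set `G_x` of all `U ∈ Ω` which contain `x`. -/
def halfClopenAt (x : ℕ → Bool) : Set HalfClopen := {U | x ∈ U.1}

theorem isIdeal_soleckiIdeal : IsIdeal soleckiIdeal where
  mono := by
    rintro A B ⟨F, hF, h⟩ hBA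
    exact ⟨F, hF, hBA.trans h⟩
  union := by
    rintro A B ⟨F, hF, h⟩ ⟨F', hF', h'⟩
    exact ⟨F ∪ F', hF.union hF', by
      rw [biUnion_union]
      exact union_subset_union h h'⟩
  finite := by
    intro A hA
    have hne : ∀ U : HalfClopen, ∃ x, x ∈ U.1 := fun U => by
      refine nonempty_iff_ne_empty.2 fun h => ?_
      have := U.2.2
      rw [h, measure_empty] at this
      exact absurd this.symm (by simp)
    choose p hp using hne
    exact ⟨p '' A, hA.image p, fun U hU => mem_biUnion (mem_image_of_mem p hU) (hp U)⟩

theorem halfClopenAt_mem (x : ℕ → Bool) : halfClopenAt x ∈ soleckiIdeal :=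
  ⟨{x}, finite_singleton x, by simp [halfClopenAt]⟩

theorem exists_injective_aleph_one :
    ∃ f : (ℵ₁ : Cardinal.{0}).out → ℕ → Bool, Function.Injective f := by
  have : #((ℵ₁ : Cardinal.{0}).out) ≤ #(ℕ → Bool) := by
    rw [Cardinal.mk_out]
    simpa using Cardinal.aleph_one_le_continuum
  obtain ⟨f⟩ := Cardinal.le_def _ _ |>.1 this
  exact ⟨f, f.injective⟩

theorem not_countable_aleph_one_out : ¬ Countable (ℵ₁ : Cardinal.{0}).out := by
  rw [← Cardinal.mk_le_aleph0_iff, Cardinal.mk_out, not_le]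
  exact Cardinal.aleph0_lt_aleph_one

/-- Countably many members of the ideal involve only countably many points, and `G_x` is covered
by finitely many sets `G_y` only if `x` is one of the `y`. -/
theorem addOmega_soleckiIdeal_le :
    addOmega soleckiIdeal ≤ ((ℵ₁ : Cardinal.{0}) : WithTop Cardinal.{0}) := by
  obtain ⟨f, hf⟩ := exists_injective_aleph_one
  by_contra! hlt
  rw [addOmega_eq] at hlt
  obtain ⟨B, hB, h⟩ := exists_bound (ι := (ℵ₁ : Cardinal.{0}).out) (fun a => halfClopenAt (f a))
    (fun a => halfClopenAt_mem _) (by rwa [Cardinal.mk_out])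
  choose F hF hBF using hB
  have hc : (⋃ n, F n).Countable := countable_iUnion fun n => (hF n).countable
  refine not_countable_aleph_one_out (countable_univ_iff.1 ((hc.preimage hf).mono fun a _ => ?_))
  obtain ⟨n, hn⟩ := h a
  refine mem_iUnion.2 ⟨n, by_contra fun ha => ?_⟩
  obtain ⟨U, hU, hU'⟩ := exists_halfClopen (hF n) ha
  obtain ⟨y, hy, hyU⟩ := mem_iUnion₂.1 (hBF n (hn hU))
  exact hU' y hy hyU

/-- Given a partition into members of the ideal, one of `ℵ₁` disjoint sequences `x₀, x₁, …` of
points avoids the countably many points involved. A finite set `H` misses some `xₙ`, so that some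
`U ∋ xₙ` avoids both `H` and the points involved in the first `n` terms of the partition. -/
theorem bS_soleckiIdeal_le :
    bS soleckiIdeal ≤ ((ℵ₁ : Cardinal.{0}) : WithTop Cardinal.{0}) := by
  obtain ⟨f', hf'⟩ := exists_injective_aleph_one
  obtain ⟨e⟩ : Nonempty ((ℵ₁ : Cardinal.{0}).out × ℕ ≃ (ℵ₁ : Cardinal.{0}).out) := by
    refine Cardinal.eq.1 ?_
    rw [Cardinal.mk_prod, Cardinal.lift_id, Cardinal.lift_id, Cardinal.mk_out, Cardinal.mk_nat]
    exact Cardinal.mul_aleph0_eq Cardinal.aleph0_lt_aleph_one.le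
  let f := f' ∘ e
  have hf : Function.Injective f := hf'.comp e.injective
  let F : (ℵ₁ : Cardinal.{0}).out → ℕ → Set HalfClopen :=
    fun a n => ⋃ i ≤ n, halfClopenAt (f (a, i))
  have hFm : ∀ a, F a ∈ MonoSeq soleckiIdeal := fun a =>
    isIdeal_soleckiIdeal.biUnion_le_mem_monoSeq fun i => halfClopenAt_mem _
  by_contra! hlt
  rw [bS_eq] at hlt
  obtain ⟨A, hA, h⟩ := exists_bound (ι := (ℵ₁ : Cardinal.{0}).out) (fun a => disjointed (F a))
    (fun a => isIdeal_soleckiIdeal.disjointed_mem_disjSeq (hFm a).1) (by rwa [Cardinal.mk_out])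
  have hA1 := hA.1.1
  choose P hP hAP using hA1
  have hc : (⋃ n, P n).Countable := countable_iUnion fun n => (hP n).countable
  refine not_countable_aleph_one_out (countable_univ_iff.1
    (((hc.preimage hf).image Prod.fst).mono fun a _ => ?_))
  by_contra ha
  have ha' : ∀ i n, f (a, i) ∉ P n := fun i n hin =>
    ha ⟨(a, i), mem_iUnion.2 ⟨n, hin⟩, rfl⟩
  obtain ⟨H, hH, hHc⟩ := h a
  obtain ⟨n, hn⟩ : ∃ n, f (a, n) ∉ H := by
    by_contra! hall
    exact infinite_of_injective_forall_mem (hf.comp (Prod.mk_right_injective a)) hall hH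
  obtain ⟨U, hU, hU'⟩ := exists_halfClopen
    (hH.union ((finite_Iic n).biUnion fun i _ => hP i)) (x := f (a, n))
    (by rintro (h | h)
        · exact hn h
        · obtain ⟨i, -, hi⟩ := mem_iUnion₂.1 h
          exact ha' n i hi)
  have hUF : U ∈ F a n := mem_biUnion (show n ≤ n from le_rfl) hU
  obtain ⟨j, hj⟩ := mem_iUnion.1 (hA.2 ▸ mem_univ U : U ∈ ⋃ n, A n)
  rcases le_or_gt j n with hjn | hjn
  · obtain ⟨y, hy, hyU⟩ := mem_iUnion₂.1 (hAP j hj)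
    exact hU' y (Or.inr (mem_biUnion (show j ∈ Iic n from hjn) hy)) hyU
  · obtain ⟨k, rfl⟩ : ∃ k, j = k + 1 := ⟨j - 1, by omega⟩
    have hmono := IsIdeal.monotone_of_mem_monoSeq (hFm a)
    have : U ∈ ⋃ n, A (n + 1) ∩ ⋃ i ≤ n, disjointed (F a) i := by
      refine mem_iUnion.2 ⟨k, hj, ?_⟩
      rw [IsIdeal.biUnion_le_disjointed hmono]
      exact hmono (by omega) hUF
    obtain ⟨y, hy, hyU⟩ := mem_iUnion₂.1 (hHc this)
    exact hU' y (Or.inl hy) hyU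

/-! ### Exhaustive ideals of submeasures -/

/-- The exhaustive ideal of a countably subadditive submeasure on `ℕ`: the sets whose tails have
submeasure tending to `0`. -/
def exh (φ : OuterMeasure ℕ) : Set (Set ℕ) :=
  {A | Tendsto (fun k => φ (A \ Iio k)) atTop (𝓝 0)}

section Exh

variable {φ : OuterMeasure ℕ}

theorem isIdeal_exh (φ : OuterMeasure ℕ) : IsIdeal (exh φ) where
  mono hA hBA := tendsto_of_tendsto_of_tendsto_of_le_of_le tendsto_const_nhds hA
    (fun _ => zero_le) fun _ => φ.mono (sdiff_subset_sdiff_left hBA)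
  union {A B} hA hB := by
    have h := Tendsto.add (show Tendsto (fun k => φ (A \ Iio k)) atTop (𝓝 0) from hA)
      (show Tendsto (fun k => φ (B \ Iio k)) atTop (𝓝 0) from hB)
    rw [add_zero] at h
    refine tendsto_of_tendsto_of_tendsto_of_le_of_le tendsto_const_nhds h
      (fun _ => zero_le) fun k => ?_
    simp only [union_sdiff_distrib]
    exact measure_union_le _ _
  finite {A} hA := by
    obtain ⟨N, hN⟩ := hA.bddAbove
    refine tendsto_const_nhds.congr' ?_
    filter_upwards [eventually_gt_atTop N] with k hk
    have : A \ Iio k = ∅ := by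
      refine sdiff_eq_empty.2 fun x hx => ?_
      exact (hN hx).trans_lt hk
    rw [this, measure_empty]

theorem iUnion_mem_exh {C : ℕ → Set ℕ} (hC : ∀ n, C n ∈ exh φ) (hs : ∑' n, φ (C n) ≠ ⊤) :
    (⋃ n, C n) ∈ exh φ := by
  refine ENNReal.tendsto_nhds_zero.2 fun ε hε => ?_
  have hε2 : 0 < ε / 2 := ENNReal.half_pos hε.ne'
  obtain ⟨N, hN⟩ :=
    (ENNReal.tendsto_nhds_zero.1 (ENNReal.tendsto_sum_nat_add _ hs) _ hε2).exists
  filter_upwards [ENNReal.tendsto_nhds_zero.1 ((isIdeal_exh φ).biUnion_le hC N) _ hε2] with k hk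
  calc φ ((⋃ n, C n) \ Iio k)
      ≤ φ (((⋃ i ≤ N, C i) \ Iio k) ∪ ⋃ n, C (n + N)) := by
        refine φ.mono fun x hx => ?_
        obtain ⟨n, hn⟩ := mem_iUnion.1 hx.1
        rcases le_total n N with h | h
        · exact Or.inl ⟨mem_biUnion (show n ≤ N from h) hn, hx.2⟩
        · exact Or.inr (mem_iUnion.2 ⟨n - N, by rwa [Nat.sub_add_cancel h]⟩)
    _ ≤ ε / 2 + ε / 2 :=
        (measure_union_le _ _).trans (add_le_add hk ((measure_iUnion_le _).trans hN))
    _ = ε := ENNReal.add_halves ε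

theorem tsum_two_inv_pow_ne_top : ∑' n : ℕ, (2⁻¹ : ENNReal) ^ n ≠ ⊤ := by
  rw [ENNReal.tsum_geometric, ENNReal.one_sub_inv_two, inv_inv]
  exact ENNReal.ofNat_ne_top

theorem iUnion_mem_exh_of_le {C : ℕ → Set ℕ} (hC : ∀ n, C n ∈ exh φ)
    (hs : ∀ n, φ (C n) ≤ 2⁻¹ ^ n) : (⋃ n, C n) ∈ exh φ :=
  iUnion_mem_exh hC (ne_top_of_le_ne_top tsum_two_inv_pow_ne_top (ENNReal.tsum_le_tsum hs))

theorem exists_tail_le {A : Set ℕ} (hA : A ∈ exh φ) {ε : ENNReal} (hε : 0 < ε) :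
    ∃ k, φ (A \ Iio k) ≤ ε :=
  (ENNReal.tendsto_nhds_zero.1 hA ε hε).exists

theorem bNumber_le_bS_exh (φ : OuterMeasure ℕ) : bNumber ≤ bS (exh φ) := by
  refine (isIdeal_exh φ).bNumber_le_bS fun F hF => ?_
  have : ∀ n, ∃ k, φ (F n \ Iio k) ≤ 2⁻¹ ^ n := fun n =>
    exists_tail_le (hF.1 n) (ENNReal.pow_pos (by simp) n)
  choose f hf using this
  refine ⟨f, fun g _ hg => ?_⟩
  obtain ⟨N, hN⟩ := eventually_atTop.1 hg
  refine (isIdeal_exh φ).mono ((isIdeal_exh φ).union ((isIdeal_exh φ).biUnion_le hF.1 N)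
    (iUnion_mem_exh_of_le (fun n => (isIdeal_exh φ).mono (hF.1 n) sdiff_subset) hf))
    (iUnion_subset fun n x hx => ?_)
  rcases le_total n N with h | h
  · exact Or.inl (mem_biUnion (show n ≤ N from h) hx.1)
  · exact Or.inr (mem_iUnion.2 ⟨n, hx.1, fun hlt => hx.2 (lt_of_lt_of_le hlt (hN n h))⟩)

end Exh

/-! ### The localization number -/

/-- Slaloms: sequences of finite sets `S n` of at most `8 ^ n` natural numbers. -/
def slaloms : Set (ℕ → Finset ℕ) := {S | ∀ n, (S n).card ≤ 8 ^ n}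

/-- The localization number: the least size of a family of functions which are not all eventually
captured by a single slalom. -/
noncomputable def locNumber : WithTop Cardinal.{0} :=
  boundingNumber univ (fun (f : ℕ → ℕ) (S : ℕ → Finset ℕ) => ∀ᶠ n in atTop, f n ∈ S n) slaloms

theorem locNumber_le_bNumber : locNumber ≤ bNumber := by
  rw [bNumber_eq]
  refine boundingNumber_le_of_tukey id (fun S n => (S n).sup id) (fun _ _ => mem_univ _)
    (fun _ _ => mem_univ _) fun f _ S _ h => ?_
  filter_upwards [h] with n hn using Finset.le_sup (f := id) hn

/-- Countably many slaloms of width `4 ^ n` are absorbed by one of width `8 ^ n`. -/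
theorem exists_slalom (T : ℕ → ℕ → Set ℕ)
    (hT : ∀ j, ∀ᶠ n in atTop, ∀ M : Finset ℕ, (M : Set ℕ) ⊆ T j n → M.card ≤ 4 ^ n) :
    ∃ S ∈ slaloms, ∀ f : ℕ → ℕ, (∃ j, ∀ᶠ n in atTop, f n ∈ T j n) → ∀ᶠ n in atTop, f n ∈ S n := by
  have : ∀ j n, ∃ F : Finset ℕ, F.card ≤ 4 ^ n ∧
      ((∀ M : Finset ℕ, (M : Set ℕ) ⊆ T j n → M.card ≤ 4 ^ n) → T j n ⊆ F) := by
    intro j n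
    by_cases h : ∀ M : Finset ℕ, (M : Set ℕ) ⊆ T j n → M.card ≤ 4 ^ n
    · have hfin : (T j n).Finite := by
        by_contra hinf
        obtain ⟨M, hM, hc⟩ := Set.Infinite.exists_subset_card_eq hinf (4 ^ n + 1)
        have := h M hM
        omega
      exact ⟨hfin.toFinset, h _ (by simp), by simp⟩
    · exact ⟨∅, by simp, fun h' => absurd h' h⟩
  choose F hF hTF using this
  refine ⟨fun n => (Finset.range (n + 1)).biUnion fun j => F j n, fun n => ?_, ?_⟩
  · refine (Finset.card_biUnion_le_card_mul _ _ _ fun j _ => hF j n).trans ?_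
    rw [Finset.card_range, show (8 : ℕ) = 2 * 4 by norm_num, mul_pow]
    exact Nat.mul_le_mul_right _ Nat.lt_two_pow_self
  · rintro f ⟨j, hj⟩
    filter_upwards [hj, hT j, eventually_ge_atTop j] with n h1 h2 h3
    exact Finset.mem_biUnion.2 ⟨j, by simpa using Nat.lt_succ_of_le h3, hTF j n h2 h1⟩

/-- Let each code `q` stand for the set `D q`. The union of the sets whose codes lie in `S n`, where
sets of submeasure above `16⁻¹ ^ n` are ignored. -/
def captured {α β : Type} [Encodable β] (φ : OuterMeasure α) (D : β → Set α) (S : ℕ → Finset ℕ)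
    (n : ℕ) : Set α :=
  ⋃ q ∈ {q : β | Encodable.encode q ∈ S n ∧ φ (D q) ≤ 16⁻¹ ^ n}, D q

section Captured

variable {α β : Type} [Encodable β] {φ : OuterMeasure α} {D : β → Set α} {S : ℕ → Finset ℕ}

theorem finite_codes (n : ℕ) :
    {q : β | Encodable.encode q ∈ S n ∧ φ (D q) ≤ 16⁻¹ ^ n}.Finite :=
  ((S n).finite_toSet.preimage Encodable.encode_injective.injOn).subset fun _ hq => hq.1

theorem captured_le (hS : S ∈ slaloms) (n : ℕ) : φ (captured φ D S n) ≤ 2⁻¹ ^ n := by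
  have hf := finite_codes (φ := φ) (D := D) (S := S) n
  have hcard : hf.toFinset.card ≤ 8 ^ n :=
    (Finset.card_le_card_of_injOn Encodable.encode (fun q hq => (hf.mem_toFinset.1 hq).1)
      Encodable.encode_injective.injOn).trans (hS n)
  calc φ (captured φ D S n) ≤ ∑ q ∈ hf.toFinset, φ (D q) := by
        refine (φ.mono ?_).trans (measure_biUnion_finset_le _ _)
        simp [captured]
    _ ≤ hf.toFinset.card • (16⁻¹ : ENNReal) ^ n :=
        Finset.sum_le_card_nsmul _ _ _ fun q hq => (hf.mem_toFinset.1 hq).2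
    _ ≤ (8 : ENNReal) ^ n * 16⁻¹ ^ n := by
      rw [nsmul_eq_mul]
      gcongr
      exact_mod_cast hcard
    _ = 2⁻¹ ^ n := by
      rw [← mul_pow, show (16 : ENNReal) = 8 * 2 by norm_num,
        ENNReal.mul_inv (by simp) (by simp), ← mul_assoc,
        ENNReal.mul_inv_cancel (by simp) (by simp), one_mul]

end Captured

/-- The cut points `k` with `φ (A \ [0, k))` small are dominated by a single function `G`, and the
sets `A ∩ [G n, G (n + 1))` are then localized by a slalom, whose members of small submeasure have
an exhaustive union. -/
theorem locNumber_le_addOmega_exh (φ : OuterMeasure ℕ) : locNumber ≤ addOmega (exh φ) := by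
  classical
  rw [addOmega_eq]
  refine le_boundingNumber fun 𝓐 h𝓐 hc => ?_
  have hk : ∀ (A : 𝓐) n, ∃ k, φ (A.1 \ Iio k) ≤ 16⁻¹ ^ n := fun A n =>
    exists_tail_le (h𝓐 A.2) (ENNReal.pow_pos (by simp) n)
  choose k hk using hk
  have hb := hc.trans_le locNumber_le_bNumber
  rw [bNumber_eq] at hb
  obtain ⟨g, -, hg⟩ := exists_bound k (fun _ => mem_univ _) hb
  let G : ℕ → ℕ := fun n => n + ∑ j ∈ Finset.range (n + 1), g j
  have hG : Monotone G := monotone_nat_of_le_succ fun n => by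
    simp only [G]
    rw [Finset.sum_range_succ g (n + 1)]
    omega
  have hnG : ∀ n, n ≤ G n := fun n => Nat.le_add_right _ _
  have hgG : ∀ n, g n ≤ G n := fun n =>
    (Finset.single_le_sum (f := g) (fun _ _ => Nat.zero_le _) (by simp)).trans
      (Nat.le_add_left _ _)
  let piece : Set ℕ → ℕ → Finset ℕ := fun A n =>
    (Finset.Ico (G n) (G (n + 1))).filter (· ∈ A)
  obtain ⟨S, hS, hcap⟩ := exists_bound (fun (A : 𝓐) n => Encodable.encode (piece A n))
    (fun _ => mem_univ _) hc
  let C : ℕ → Set ℕ := captured φ (fun s : Finset ℕ => (s : Set ℕ)) S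
  have hC : (⋃ n, C n) ∈ exh φ :=
    iUnion_mem_exh_of_le (fun n => (isIdeal_exh φ).finite
      ((finite_codes n).biUnion fun s _ => s.finite_toSet)) fun n => captured_le hS n
  refine ⟨fun j => (⋃ n, C n) ∪ Iio j,
    fun j => (isIdeal_exh φ).union hC ((isIdeal_exh φ).finite (finite_Iio j)), fun A hA => ?_⟩
  obtain ⟨N, hN⟩ := eventually_atTop.1 ((hcap ⟨A, hA⟩).and (hg ⟨A, hA⟩))
  refine ⟨G N, fun x hx => or_iff_not_imp_right.2 fun hxN => ?_⟩
  -- the piece containing `x`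
  have hex : ∃ n, x < G (n + 1) := ⟨x, hnG (x + 1)⟩
  let n := Nat.find hex
  have hn1 : x < G (n + 1) := Nat.find_spec hex
  have hNn : N ≤ n := by
    by_contra! hlt
    exact hxN (hn1.trans_le (hG hlt))
  have hn2 : G n ≤ x := by
    rcases hNn.eq_or_lt with h | h
    · rw [← h]
      exact not_lt.1 hxN
    · have := Nat.find_min hex (m := n - 1) (by omega)
      rwa [Nat.sub_add_cancel (by omega), not_lt] at this
  refine mem_iUnion.2 ⟨n, mem_biUnion (x := piece A n) ⟨(hN n hNn).1, ?_⟩ ?_⟩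
  · refine (φ.mono fun y hy => ?_).trans (hk ⟨A, hA⟩ n)
    obtain ⟨hy1, hy2⟩ := Finset.mem_filter.1 hy
    exact ⟨hy2, not_lt.2 ((((hN n hNn).2).trans (hgG n)).trans (Finset.mem_Ico.1 hy1).1)⟩
  · exact Finset.mem_filter.2 ⟨Finset.mem_Ico.2 ⟨hn2, hn1⟩, hx⟩

/-! ### Submeasures comparable with the proportion in dyadic blocks -/

/-- The submeasure of a subset of `[2 ^ p, 2 ^ (p + 1))` lies between a quarter of its proportion
of that block and this proportion itself. -/
structure IsDyadic (φ : OuterMeasure ℕ) : Prop where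
  le : ∀ (p : ℕ) (s : Finset ℕ), s ⊆ Finset.Ico (2 ^ p) (2 ^ (p + 1)) → 2 ^ p * φ s ≤ s.card
  ge : ∀ (p : ℕ) (s : Finset ℕ), s ⊆ Finset.Ico (2 ^ p) (2 ^ (p + 1)) →
    (s.card : ENNReal) ≤ 2 ^ (p + 2) * φ s

/-- The inequality `(1 - 1 / L) ^ r ≤ 1 / 2` for `r ≥ L`, with `L = a + 1`. -/
theorem two_mul_pow_le (a r : ℕ) (h : a + 1 ≤ r) : 2 * a ^ r ≤ (a + 1) ^ r := by
  have key : ∀ r, a ^ r * (a + r) ≤ (a + 1) ^ r * a := by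
    intro r
    induction r with
    | zero => simp
    | succ r ih =>
      calc a ^ (r + 1) * (a + (r + 1)) ≤ a ^ r * (a + r) * (a + 1) := by
            rw [pow_succ]
            have : a * (a + (r + 1)) ≤ (a + r) * (a + 1) := by nlinarith
            calc a ^ r * a * (a + (r + 1)) = a ^ r * (a * (a + (r + 1))) := by ring
              _ ≤ a ^ r * ((a + r) * (a + 1)) := Nat.mul_le_mul_left _ this
              _ = _ := by ring
        _ ≤ (a + 1) ^ r * a * (a + 1) := Nat.mul_le_mul_right _ ih
        _ = (a + 1) ^ (r + 1) * a := by ring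
  rcases Nat.eq_zero_or_pos a with rfl | ha
  · rw [zero_pow (by omega)]
    simp
  · refine Nat.le_of_mul_le_mul_right ?_ ha
    calc 2 * a ^ r * a = a ^ r * (a + a) := by ring
      _ ≤ a ^ r * (a + r) := Nat.mul_le_mul_left _ (by omega)
      _ ≤ _ := key r

theorem card_filter_forall_ne_zero (k L : ℕ) (M : Finset (Fin k)) :
    (Finset.univ.filter fun x : Fin k → Fin (L + 1) => ∀ m ∈ M, x m ≠ 0).card * (L + 1) ^ M.card =
      L ^ M.card * (L + 1) ^ k := by
  have : (Finset.univ.filter fun x : Fin k → Fin (L + 1) => ∀ m ∈ M, x m ≠ 0) =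
      Fintype.piFinset fun m => if m ∈ M then Finset.univ.erase 0 else Finset.univ := by
    ext x
    simp only [Finset.mem_filter, Finset.mem_univ, true_and, Fintype.mem_piFinset]
    refine forall_congr' fun m => ?_
    by_cases h : m ∈ M <;> simp [h]
  rw [this, Fintype.card_piFinset]
  have h2 : ∀ m, (if m ∈ M then (Finset.univ.erase 0 : Finset (Fin (L + 1)))
      else Finset.univ).card = if m ∈ M then L else L + 1 := fun m => by
    by_cases h : m ∈ M <;> simp [h]
  simp only [h2]
  rw [Finset.prod_ite]
  have h3 : (Finset.univ.filter fun m => m ∉ M).card + M.card = k := by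
    have := Finset.card_filter_add_card_filter_not (s := (Finset.univ : Finset (Fin k))) (· ∈ M)
    simp only [Finset.filter_univ_mem, Finset.card_univ, Fintype.card_fin] at this
    omega
  simp only [Finset.prod_const, Finset.filter_univ_mem]
  rw [mul_assoc, ← pow_add, h3]

/-- For numbers below `2 ^ (i * k)`, written with `k` digits in base `2 ^ i`, the sets of those
having a given digit zero are independent, here shifted into `[2 ^ (i * k), 2 ^ (i * k + 1))`: each
has proportion `2⁻¹ ^ i`, and the union of any `2 ^ i` of them has proportion at least one half. -/
theorem exists_independent (i k : ℕ) : ∃ W : ℕ → Finset ℕ,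
    (∀ m, W m ⊆ Finset.Ico (2 ^ (i * k)) (2 ^ (i * k + 1))) ∧
    (∀ m, (W m).card * 2 ^ i ≤ 2 ^ (i * k)) ∧
    ∀ M ⊆ Finset.range k, 2 ^ i ≤ M.card → 2 ^ (i * k) ≤ 2 * (M.biUnion W).card := by
  classical
  obtain ⟨L, hL⟩ : ∃ L, 2 ^ i = L + 1 := ⟨2 ^ i - 1, by have := Nat.one_le_two_pow (n := i); omega⟩
  have hik : (2 : ℕ) ^ (i * k) = (L + 1) ^ k := by rw [pow_mul, hL]
  let e : (Fin k → Fin (L + 1)) ↪ ℕ :=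
    ⟨fun x => 2 ^ (i * k) + finFunctionFinEquiv x, fun x y h =>
      finFunctionFinEquiv.injective (Fin.ext (Nat.add_left_cancel h))⟩
  have he : ∀ x, e x ∈ Finset.Ico (2 ^ (i * k)) (2 ^ (i * k + 1)) := fun x => by
    have := (finFunctionFinEquiv x).2
    have h : e x = 2 ^ (i * k) + finFunctionFinEquiv x := rfl
    rw [Finset.mem_Ico, h, pow_succ]
    omega
  let Z : ℕ → Finset (Fin k → Fin (L + 1)) := fun m =>
    if h : m < k then Finset.univ.filter fun x => x ⟨m, h⟩ = 0 else ∅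
  refine ⟨fun m => (Z m).map e, fun m x hx => ?_, fun m => ?_, fun M hM hc => ?_⟩
  · obtain ⟨y, -, rfl⟩ := Finset.mem_map.1 hx
    exact he y
  · rw [Finset.card_map]
    by_cases h : m < k
    · have h1 := card_filter_forall_ne_zero k L {⟨m, h⟩}
      have h2 := Finset.card_filter_add_card_filter_not
        (s := (Finset.univ : Finset (Fin k → Fin (L + 1)))) (fun x => x ⟨m, h⟩ = 0)
      simp only [Finset.mem_singleton, forall_eq, Finset.card_singleton, pow_one] at h1
      rw [Finset.card_univ, Fintype.card_fun, Fintype.card_fin, Fintype.card_fin] at h2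
      simp only [Z, h, dif_pos]
      rw [hL, hik]
      nlinarith
    · simp [Z, h]
  · -- regard `M` as a set of digit positions
    let M' : Finset (Fin k) := Finset.univ.filter fun m => (m : ℕ) ∈ M
    have hM' : M'.card = M.card := by
      rw [← Finset.card_map Fin.valEmbedding]
      congr 1
      ext m
      simp only [M', Finset.mem_map, Finset.mem_filter, Finset.mem_univ, true_and,
        Fin.valEmbedding_apply]
      exact ⟨by rintro ⟨a, ha, rfl⟩; exact ha, fun h => ⟨⟨m, by simpa using hM h⟩, h, rfl⟩⟩
    have h1 := card_filter_forall_ne_zero k L M'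
    have h2 := Finset.card_filter_add_card_filter_not
        (s := (Finset.univ : Finset (Fin k → Fin (L + 1)))) (fun x => ∀ m ∈ M', x m ≠ 0)
    rw [Finset.card_univ, Fintype.card_fun, Fintype.card_fin, Fintype.card_fin] at h2
    have h3 : (Finset.univ.filter fun x : Fin k → Fin (L + 1) => ¬ ∀ m ∈ M', x m ≠ 0).map e ⊆
        M.biUnion fun m => (Z m).map e := by
      intro y hy
      obtain ⟨x, hx, rfl⟩ := Finset.mem_map.1 hy
      simp only [Finset.mem_filter, Finset.mem_univ, true_and, not_forall, not_not] at hx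
      obtain ⟨m, hm, h0⟩ := hx
      refine Finset.mem_biUnion.2 ⟨m, (Finset.mem_filter.1 hm).2, Finset.mem_map_of_mem _ ?_⟩
      simp [Z, h0]
    have h4 := Finset.card_le_card h3
    rw [Finset.card_map] at h4
    have h5 := two_mul_pow_le L M'.card (by omega)
    have h6 : 2 * (Finset.univ.filter fun x : Fin k → Fin (L + 1) => ∀ m ∈ M', x m ≠ 0).card ≤
        (L + 1) ^ k := by
      refine Nat.le_of_mul_le_mul_right ?_ (pow_pos (Nat.succ_pos L) M'.card)
      calc _ = 2 * (L ^ M'.card * (L + 1) ^ k) := by rw [mul_assoc, h1]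
        _ = 2 * L ^ M'.card * (L + 1) ^ k := by ring
        _ ≤ (L + 1) ^ M'.card * (L + 1) ^ k := Nat.mul_le_mul_right _ h5
        _ = _ := mul_comm _ _
    rw [hik]
    omega

namespace IsDyadic

variable {φ : OuterMeasure ℕ}

theorem le_two_inv_pow (hφ : IsDyadic φ) {p i : ℕ} {s : Finset ℕ}
    (hs : s ⊆ Finset.Ico (2 ^ p) (2 ^ (p + 1))) (hc : s.card * 2 ^ i ≤ 2 ^ p) :
    φ s ≤ 2⁻¹ ^ i := by
  have h1 : (2 : ENNReal) ^ p * (φ s * 2 ^ i) ≤ 2 ^ p * 1 := by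
    calc (2 : ENNReal) ^ p * (φ s * 2 ^ i) = 2 ^ p * φ s * 2 ^ i := by ring
      _ ≤ s.card * 2 ^ i := by gcongr; exact hφ.le p s hs
      _ ≤ 2 ^ p * 1 := by rw [mul_one]; exact_mod_cast hc
  have h2 := (ENNReal.mul_le_mul_iff_right (by simp) (by simp)).1 h1
  rw [← ENNReal.inv_pow]
  exact ENNReal.le_inv_iff_mul_le.2 h2

theorem two_inv_pow_le (hφ : IsDyadic φ) {p i : ℕ} {s : Finset ℕ}
    (hs : s ⊆ Finset.Ico (2 ^ p) (2 ^ (p + 1))) (hc : 2 ^ p ≤ s.card * 2 ^ i) :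
    2⁻¹ ^ (i + 2) ≤ φ s := by
  have h1 : (2 : ENNReal) ^ p * 1 ≤ 2 ^ p * (2 ^ (i + 2) * φ s) := by
    calc (2 : ENNReal) ^ p * 1 ≤ s.card * 2 ^ i := by rw [mul_one]; exact_mod_cast hc
      _ ≤ 2 ^ (p + 2) * φ s * 2 ^ i := by gcongr; exact hφ.ge p s hs
      _ = 2 ^ p * (2 ^ (i + 2) * φ s) := by ring
  have h2 := (ENNReal.mul_le_mul_iff_right (by simp) (by simp)).1 h1
  rw [← ENNReal.inv_pow]
  exact ENNReal.inv_le_iff_le_mul (by simp) (by simp) |>.2 h2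

theorem bS_le_bNumber (hφ : IsDyadic φ) : bS (exh φ) ≤ bNumber := by
  refine (isIdeal_exh φ).bS_le_bNumber (fun m => (Finset.Ico (2 ^ m) (2 ^ (m + 1)) : Finset ℕ))
    (fun m => (isIdeal_exh φ).finite (Finset.finite_toSet _))
    -- the block has submeasure at least `1 / 4`
    (fun m A => φ (A ∩ Ici m) < 2⁻¹ ^ 3) (fun A hA => ?_) fun m A B hA hB hc => ?_
  · filter_upwards [(tendsto_order.1 hA).2 _ (ENNReal.pow_pos (by simp : (0 : ENNReal) < 2⁻¹) 3)]
      with m hm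
    rwa [sdiff_eq, compl_Iio] at hm
  · have h1 := hφ.two_inv_pow_le (i := 0) (Finset.Subset.refl (Finset.Ico (2 ^ m) (2 ^ (m + 1))))
      (by rw [Nat.card_Ico, pow_succ]; omega)
    have h2 : φ (Finset.Ico (2 ^ m) (2 ^ (m + 1)) : Finset ℕ) ≤
        φ (A ∩ Ici m) + φ (B ∩ Ici m) := by
      refine (φ.mono fun x hx => ?_).trans (measure_union_le _ _)
      have hmx : x ∈ Ici m :=
        (Nat.lt_two_pow_self (n := m)).le.trans (Finset.mem_Ico.1 (Finset.mem_coe.1 hx)).1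
      exact (hc hx).imp (fun h => ⟨h, hmx⟩) fun h => ⟨h, hmx⟩
    refine absurd (h1.trans h2) (not_le.2 ((ENNReal.add_lt_add hA hB).trans_eq ?_))
    rw [zero_add, pow_succ _ 2, ← mul_add, ENNReal.inv_two_add_inv_two, mul_one]

/-- The initial segment of proportion `2⁻¹ ^ n` of a dyadic block that depends injectively on
`(n, m)`. -/
def chunk (n m : ℕ) : Finset ℕ :=
  Finset.Ico (2 ^ Nat.pair n m) (2 ^ Nat.pair n m + 2 ^ (Nat.pair n m - n))

theorem chunk_subset (n m : ℕ) :
    chunk n m ⊆ Finset.Ico (2 ^ Nat.pair n m) (2 ^ (Nat.pair n m + 1)) := by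
  refine Finset.Ico_subset_Ico_right ?_
  have : 2 ^ (Nat.pair n m - n) ≤ 2 ^ Nat.pair n m :=
    Nat.pow_le_pow_right (by norm_num) (Nat.sub_le _ _)
  rw [pow_succ]
  omega

theorem card_chunk (n m : ℕ) : (chunk n m).card * 2 ^ n = 2 ^ Nat.pair n m := by
  rw [chunk, Nat.card_Ico, Nat.add_sub_cancel_left, ← pow_add,
    Nat.sub_add_cancel (Nat.left_le_pair n m)]

/-- A member of the ideal contains, for each `n`, only finitely many of the sets `chunk n m`. -/
theorem addOmega_le_bNumber (hφ : IsDyadic φ) : addOmega (exh φ) ≤ bNumber := by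
  have hg : ∀ B ∈ exh φ, ∃ g : ℕ → ℕ, ∀ n m, (chunk n m : Set ℕ) ⊆ B → m ≤ g n := by
    intro B hB
    have : ∀ n, ∃ k, ∀ m, (chunk n m : Set ℕ) ⊆ B → m ≤ k := fun n => by
      obtain ⟨k, hk⟩ := eventually_atTop.1 ((tendsto_order.1 hB).2 _
        (ENNReal.pow_pos (by simp : (0 : ENNReal) < 2⁻¹) (n + 2)))
      refine ⟨k, fun m hm => by_contra fun hlt => ?_⟩
      refine absurd (hk m (by omega)) (not_lt.2 ?_)
      refine (hφ.two_inv_pow_le (chunk_subset n m) (card_chunk n m).ge).trans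
        (φ.mono fun x hx => ⟨hm hx, notMem_Iio.2 ?_⟩)
      exact ((Nat.right_le_pair n m).trans Nat.lt_two_pow_self.le).trans
        (Finset.mem_Ico.1 (Finset.mem_coe.1 hx)).1
    choose g hg using this
    exact ⟨g, hg⟩
  choose! g hg using hg
  rw [addOmega_eq, bNumber_eq]
  refine boundingNumber_le_of_tukey (fun f => ⋃ n, (chunk n (f n) : Set ℕ))
    (fun B n => ∑ j ∈ Finset.range (n + 1), g (B j) n) (fun f _ => ?_) (fun _ _ => mem_univ _) ?_
  · exact iUnion_mem_exh_of_le (fun n => (isIdeal_exh φ).finite (Finset.finite_toSet _))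
      fun n => hφ.le_two_inv_pow (chunk_subset n _) (card_chunk n _).le
  · rintro f - B hB ⟨j, hj⟩
    filter_upwards [eventually_ge_atTop j] with n hn
    refine (hg _ (hB j) n (f n)
      ((subset_iUnion (fun n => (chunk n (f n) : Set ℕ)) n).trans hj)).trans
        (Finset.single_le_sum (f := fun j => g (B j) n) (fun _ _ => Nat.zero_le _) ?_)
    simpa using Nat.lt_succ_of_le hn

/-- Fewer than `addOmega` functions are dominated by some `g`. Each value at most `g i` is then
represented by one of `g i + 1` independent sets of proportion `2⁻¹ ^ i` in a single block; a member
of the ideal contains less than half of almost every block, hence fewer than `2 ^ i` of these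
sets. -/
theorem addOmega_le_locNumber (hφ : IsDyadic φ) : addOmega (exh φ) ≤ locNumber := by
  refine le_boundingNumber fun F _ hc => ?_
  have hb := hc.trans_le hφ.addOmega_le_bNumber
  rw [bNumber_eq] at hb
  obtain ⟨g, -, hg⟩ := exists_bound (fun f : F => f.1) (fun _ => mem_univ _) hb
  choose W hW1 hW2 hW3 using fun i => exists_independent i (g i + 1)
  let C : (ℕ → ℕ) → Set ℕ := fun f => ⋃ i, (W i (f i) : Set ℕ)
  have hC : ∀ f, C f ∈ exh φ := fun f =>
    iUnion_mem_exh_of_le (fun i => (isIdeal_exh φ).finite (Finset.finite_toSet _))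
      fun i => hφ.le_two_inv_pow (hW1 i _) (hW2 i _)
  rw [addOmega_eq] at hc
  obtain ⟨B, hB, hCB⟩ := exists_bound (fun f : F => C f.1) (fun f => hC f.1) hc
  have hT : ∀ j, ∀ᶠ i in atTop, ∀ M : Finset ℕ,
      (M : Set ℕ) ⊆ {m | m ≤ g i ∧ (W i m : Set ℕ) ⊆ B j} → M.card ≤ 4 ^ i := by
    intro j
    filter_upwards [(tendsto_order.1 (hB j)).2 _
      (ENNReal.pow_pos (by simp : (0 : ENNReal) < 2⁻¹) (1 + 2))] with i hi M hM
    by_contra! hlt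
    have hMc : 2 ^ i ≤ M.card := (Nat.pow_le_pow_left (by norm_num) i).trans hlt.le
    have hMr : M ⊆ Finset.range (g i + 1) := fun m hm => by
      simpa using Nat.lt_succ_of_le (hM hm).1
    have h1 := hW3 i M hMr hMc
    refine absurd hi (not_lt.2 ((hφ.two_inv_pow_le (i := 1) (s := M.biUnion (W i))
      (Finset.biUnion_subset.2 fun m _ => hW1 i m) (by omega)).trans (φ.mono fun x hx => ?_)))
    obtain ⟨m, hm, hx⟩ := Finset.mem_biUnion.1 (Finset.mem_coe.1 hx)
    refine ⟨(hM hm).2 hx, notMem_Iio.2 ?_⟩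
    calc i ≤ i * (g i + 1) := Nat.le_mul_of_pos_right _ (Nat.succ_pos _)
      _ ≤ 2 ^ (i * (g i + 1)) := Nat.lt_two_pow_self.le
      _ ≤ x := (Finset.mem_Ico.1 (hW1 i m hx)).1
  obtain ⟨S, hS, hcap⟩ := exists_slalom _ hT
  refine ⟨S, hS, fun f hf => hcap f ?_⟩
  obtain ⟨j, hj⟩ := hCB ⟨f, hf⟩
  refine ⟨j, ?_⟩
  filter_upwards [hg ⟨f, hf⟩] with i hi
  exact ⟨hi, (subset_iUnion (fun i => (W i (f i) : Set ℕ)) i).trans hj⟩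

end IsDyadic

/-! ### The density ideal and the summable ideal -/

/-- The submeasure `A ↦ sup_m |A ∩ [0, m)| / (m + 1)`. -/
noncomputable def densitySubmeasure : OuterMeasure ℕ :=
  ⨆ m : ℕ, ((m + 1 : ENNReal)⁻¹) • OuterMeasure.restrict (Iio m) Measure.count.toOuterMeasure

theorem densitySubmeasure_apply (A : Set ℕ) :
    densitySubmeasure A = ⨆ m : ℕ, ((A ∩ Iio m).ncard : ENNReal) / (m + 1) := by
  rw [densitySubmeasure, OuterMeasure.iSup_apply]
  congr 1
  ext m
  have hf : (A ∩ Iio m).Finite := (finite_Iio m).inter_of_right A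
  rw [smul_apply, OuterMeasure.restrict_apply, smul_eq_mul, mul_comm, div_eq_mul_inv,
    Measure.toOuterMeasure_apply, Measure.count_apply_finite _ hf, ncard_eq_toFinset_card _ hf]

theorem densitySubmeasure_le_iff {A : Set ℕ} {ε : ℝ} (hε : 0 ≤ ε) :
    densitySubmeasure A ≤ ENNReal.ofReal ε ↔ ∀ m : ℕ, ((A ∩ Iio m).ncard : ℝ) ≤ ε * (m + 1) := by
  rw [densitySubmeasure_apply, iSup_le_iff]
  refine forall_congr' fun m => ?_
  rw [ENNReal.div_le_iff (by simp) (by simp), ← ENNReal.ofReal_le_ofReal_iff (by positivity),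
    ENNReal.ofReal_mul hε, ENNReal.ofReal_natCast, ENNReal.ofReal_add (by positivity) (by simp),
    ENNReal.ofReal_natCast, ENNReal.ofReal_one]

theorem mem_densityIdeal_iff {A : Set ℕ} : A ∈ densityIdeal ↔
    ∀ ε : ℝ, 0 < ε → ∀ᶠ m : ℕ in atTop, ((A ∩ Iio m).ncard : ℝ) ≤ ε * (m + 1) := by
  have hpos : ∀ m : ℕ, (0 : ℝ) < m + 1 := fun m => by positivity
  constructor
  · intro h ε hε
    filter_upwards [(tendsto_order.1 h).2 ε hε] with m hm
    exact ((div_lt_iff₀ (hpos m)).1 hm).le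
  · intro h
    refine tendsto_order.2 ⟨fun a ha => Eventually.of_forall fun m =>
      ha.trans_le (div_nonneg (Nat.cast_nonneg _) (hpos m).le),
      fun a ha => ?_⟩
    filter_upwards [h (a / 2) (half_pos ha)] with m hm
    rw [div_lt_iff₀ (hpos m)]
    nlinarith [hpos m]

theorem densityIdeal_eq : densityIdeal = exh densitySubmeasure := by
  ext A
  rw [mem_densityIdeal_iff]
  constructor
  · intro h
    refine ENNReal.tendsto_nhds_zero.2 fun ε hε => ?_
    obtain ⟨δ, hδ, hδε⟩ : ∃ δ : ℝ, 0 < δ ∧ ENNReal.ofReal δ ≤ ε := by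
      obtain ⟨r, hr, hrε⟩ := ENNReal.lt_iff_exists_nnreal_btwn.1 hε
      exact ⟨r, by exact_mod_cast hr, by simpa using hrε.le⟩
    obtain ⟨N, hN⟩ := eventually_atTop.1 (h δ hδ)
    filter_upwards [eventually_ge_atTop N] with k hk
    refine ((densitySubmeasure_le_iff hδ.le).2 fun m => ?_).trans hδε
    rcases le_total m k with hm | hm
    · have : A \ Iio k ∩ Iio m = ∅ :=
        eq_empty_of_forall_notMem fun x hx => hx.1.2 (lt_of_lt_of_le hx.2 hm)
      rw [this, ncard_empty, Nat.cast_zero]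
      exact mul_nonneg hδ.le (by positivity)
    · refine le_trans ?_ (hN m (hk.trans hm))
      exact_mod_cast ncard_le_ncard (inter_subset_inter_left _ sdiff_subset)
        ((finite_Iio m).inter_of_right A)
  · intro h ε hε
    obtain ⟨k, hk⟩ := exists_tail_le (φ := densitySubmeasure) h
      (ENNReal.ofReal_pos.2 (half_pos hε))
    rw [densitySubmeasure_le_iff (half_pos hε).le] at hk
    obtain ⟨N, hN⟩ := exists_nat_ge (k / (ε / 2))
    filter_upwards [eventually_ge_atTop N] with m hm
    have h1 : (A ∩ Iio m).ncard ≤ (A \ Iio k ∩ Iio m).ncard + k := by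
      calc (A ∩ Iio m).ncard ≤ ((A \ Iio k ∩ Iio m) ∪ Iio k).ncard := by
            refine ncard_le_ncard (fun x hx => ?_)
              (((finite_Iio m).inter_of_right _).union (finite_Iio k))
            by_cases hxk : x ∈ Iio k
            · exact Or.inr hxk
            · exact Or.inl ⟨⟨hx.1, hxk⟩, hx.2⟩
        _ ≤ _ := (ncard_union_le _ _).trans_eq (by simp)
    have h2 : (k : ℝ) ≤ ε / 2 * m := by
      rw [div_le_iff₀ (by positivity)] at hN
      have : (N : ℝ) ≤ m := by exact_mod_cast hm
      nlinarith
    have h3 := hk m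
    have h1' : ((A ∩ Iio m).ncard : ℝ) ≤ (A \ Iio k ∩ Iio m).ncard + k := by exact_mod_cast h1
    nlinarith

theorem isDyadic_densitySubmeasure : IsDyadic densitySubmeasure where
  le p s hs := by
    rw [densitySubmeasure_apply, ENNReal.mul_iSup]
    refine iSup_le fun m => ?_
    rcases le_total m (2 ^ p) with hm | hm
    · have : (s : Set ℕ) ∩ Iio m = ∅ := eq_empty_of_forall_notMem fun x hx =>
        not_lt.2 (hm.trans (Finset.mem_Ico.1 (hs hx.1)).1) hx.2
      simp [this]
    · rw [← mul_div_assoc]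
      refine ENNReal.div_le_of_le_mul ?_
      have h1 : ((s : Set ℕ) ∩ Iio m).ncard ≤ s.card :=
        (ncard_le_ncard inter_subset_left s.finite_toSet).trans_eq (ncard_coe_finset s)
      rw [mul_comm]
      gcongr
      exact_mod_cast hm.trans (Nat.le_succ m)
  ge p s hs := by
    have h1 : (s : Set ℕ) ∩ Iio (2 ^ (p + 1)) = s :=
      inter_eq_left.2 fun x hx => (Finset.mem_Ico.1 (hs hx)).2
    have h2 : (s.card : ENNReal) / ((2 ^ (p + 1) : ℕ) + 1) ≤ densitySubmeasure s := by
      rw [densitySubmeasure_apply]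
      refine le_iSup_of_le (2 ^ (p + 1)) ?_
      rw [h1, ncard_coe_finset]
    rw [ENNReal.div_le_iff (by simp) (by simp), mul_comm] at h2
    refine h2.trans ?_
    gcongr
    have : 2 ^ (p + 1) + 1 ≤ 2 ^ (p + 2) := by
      have := Nat.one_le_two_pow (n := p + 1)
      rw [pow_succ 2 (p + 1)]
      omega
    exact_mod_cast this

/-- The measure on `ℕ` giving `n` the mass `1 / (n + 1)`. -/
noncomputable def harmonicMeasure : Measure ℕ :=
  Measure.count.withDensity fun n => ((n : ENNReal) + 1)⁻¹

theorem harmonicMeasure_apply (A : Set ℕ) :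
    harmonicMeasure A = ∑' n : A, ((n : ENNReal) + 1)⁻¹ := by
  rw [harmonicMeasure, withDensity_apply _ A.to_countable.measurableSet,
    ← lintegral_indicator A.to_countable.measurableSet, lintegral_count]
  exact (tsum_subtype A fun n : ℕ => ((n : ENNReal) + 1)⁻¹).symm

theorem harmonicMeasure_finset (s : Finset ℕ) :
    harmonicMeasure s = ∑ n ∈ s, ((n : ENNReal) + 1)⁻¹ := by
  rw [harmonicMeasure_apply, Finset.tsum_subtype' s fun n : ℕ => ((n : ENNReal) + 1)⁻¹]

theorem mem_summableIdeal_iff {A : Set ℕ} : A ∈ summableIdeal ↔ harmonicMeasure A ≠ ⊤ := by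
  rw [harmonicMeasure_apply]
  have h : ∀ n : A, ((n : ENNReal) + 1)⁻¹ = ((((n : ℕ) : NNReal) + 1)⁻¹ : NNReal) := fun n => by
    rw [ENNReal.coe_inv (by positivity)]
    simp
  simp_rw [h]
  rw [ENNReal.tsum_coe_ne_top_iff_summable, ← NNReal.summable_coe]
  simp [summableIdeal]

theorem summableIdeal_eq : summableIdeal = exh harmonicMeasure.toOuterMeasure := by
  have hfin : ∀ s : Set ℕ, s.Finite → harmonicMeasure s ≠ ⊤ := fun s hs => by
    rw [← hs.coe_toFinset, harmonicMeasure_finset]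
    exact ENNReal.sum_ne_top.2 fun n _ => ENNReal.inv_ne_top.2 (by simp)
  ext A
  rw [mem_summableIdeal_iff]
  constructor
  · intro h
    have := tendsto_measure_iInter_atTop (μ := harmonicMeasure) (s := fun k => A \ Iio k)
      (fun k => (to_countable _).measurableSet.nullMeasurableSet)
      (fun i j hij => sdiff_subset_sdiff_right (Iio_subset_Iio hij))
      ⟨0, ne_top_of_le_ne_top h (measure_mono sdiff_subset)⟩
    have he : ⋂ k, A \ Iio k = ∅ := eq_empty_of_forall_notMem fun x hx =>
      (mem_iInter.1 hx (x + 1)).2 (Nat.lt_succ_self x)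
    rw [he, measure_empty] at this
    exact this
  · intro h
    obtain ⟨k, hk⟩ := exists_tail_le h one_pos
    refine ne_top_of_le_ne_top (ENNReal.add_ne_top.2 ⟨hfin _ (finite_Iio k),
      ne_top_of_le_ne_top ENNReal.one_ne_top hk⟩) ((measure_mono fun x hx => ?_).trans
        (measure_union_le (μ := harmonicMeasure) (Iio k) (A \ Iio k)))
    exact (em (x ∈ Iio k)).imp id fun h => ⟨hx, h⟩

theorem isDyadic_harmonicMeasure : IsDyadic harmonicMeasure.toOuterMeasure where
  le p s hs := by
    rw [Measure.toOuterMeasure_apply, harmonicMeasure_finset, Finset.mul_sum]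
    refine (Finset.sum_le_card_nsmul s _ 1 fun n hn => ?_).trans_eq (by simp)
    rw [← div_eq_mul_inv]
    refine ENNReal.div_le_of_le_mul ?_
    rw [one_mul]
    exact_mod_cast (Finset.mem_Ico.1 (hs hn)).1.trans (Nat.le_succ n)
  ge p s hs := by
    rw [Measure.toOuterMeasure_apply, harmonicMeasure_finset, Finset.mul_sum]
    refine le_trans (by simp) (Finset.card_nsmul_le_sum s _ 1 fun n hn => ?_)
    rw [← div_eq_mul_inv, ENNReal.le_div_iff_mul_le (by simp) (by simp), one_mul]
    have h1 := (Finset.mem_Ico.1 (hs hn)).2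
    have h2 : 2 ^ (p + 1) ≤ 2 ^ (p + 2) := Nat.pow_le_pow_right (by norm_num) (Nat.le_succ _)
    exact_mod_cast h1.trans_le h2

/-! ### Null sets and localization -/

theorem exists_nat_basis : ∃ b : ℕ → Set ℝ, TopologicalSpace.IsTopologicalBasis (range b) := by
  obtain ⟨s, hs, -, hb⟩ := TopologicalSpace.exists_countable_basis ℝ
  obtain ⟨b, rfl⟩ := hs.exists_eq_range (by
    rw [nonempty_iff_ne_empty]
    rintro rfl
    exact empty_ne_univ (sUnion_empty.symm.trans hb.sUnion_eq))
  exact ⟨b, hb⟩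

/-- The difference of the unions of two finite families of basic sets. -/
def basicDiff (b : ℕ → Set ℝ) (q : Finset ℕ × Finset ℕ) : Set ℝ :=
  (⋃ i ∈ q.1, b i) \ ⋃ i ∈ q.2, b i

/-- A null set consists of points lying in infinitely many of a sequence of coded sets of
prescribed measures: an open cover is cut into the differences of its finite approximations, and
this is done for infinitely many covers. -/
theorem exists_basicDiff {b : ℕ → Set ℝ} (hb : TopologicalSpace.IsTopologicalBasis (range b))
    {A : Set ℝ} (hA : volume A = 0) {ε : ℕ → ENNReal} (hε : ∀ p, 0 < ε p) :
    ∃ f : ℕ → Finset ℕ × Finset ℕ, (∀ p, volume (basicDiff b (f p)) ≤ ε p) ∧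
      ∀ x ∈ A, ∃ᶠ p in atTop, x ∈ basicDiff b (f p) := by
  classical
  have hU : ∀ m, ∃ U ⊇ A, IsOpen U ∧ volume U < ε (Nat.pair m 0) := fun m =>
    A.exists_isOpen_lt_of_lt _ (by rw [hA]; exact hε _)
  choose U hAU hUo hUε using hU
  -- `V m k` are the finite approximations of `U m`, and `K m k` the places at which it is cut
  let F : ℕ → ℕ → Finset ℕ := fun m k => (Finset.range k).filter fun i => b i ⊆ U m
  let V : ℕ → ℕ → Set ℝ := fun m k => ⋃ i ∈ F m k, b i
  have hVU : ∀ m, ⋃ k, V m k = U m := fun m => by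
    refine Subset.antisymm (iUnion_subset fun k => iUnion₂_subset fun i hi =>
      (Finset.mem_filter.1 hi).2) fun x hx => ?_
    obtain ⟨_, ⟨i, rfl⟩, hxi, hi⟩ := hb.exists_subset_of_mem_open hx (hUo m)
    exact mem_iUnion.2 ⟨i + 1, mem_biUnion (Finset.mem_coe.2
      (Finset.mem_filter.2 ⟨by simp, hi⟩)) hxi⟩
  have hVm : ∀ m, Monotone (V m) := fun m k l hkl =>
    biUnion_subset_biUnion_left fun i hi => Finset.mem_filter.2
      ⟨Finset.range_mono hkl (Finset.mem_filter.1 hi).1, (Finset.mem_filter.1 hi).2⟩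
  have hVo : ∀ m k, IsOpen (V m k) := fun m k =>
    isOpen_biUnion fun i _ => hb.isOpen ⟨i, rfl⟩
  have hlim : ∀ m, Tendsto (fun k => volume (U m \ V m k)) atTop (𝓝 0) := fun m => by
    have := tendsto_measure_iInter_atTop (μ := volume) (s := fun k => U m \ V m k)
      (fun k => ((hUo m).measurableSet.diff (hVo m k).measurableSet).nullMeasurableSet)
      (fun k l hkl => sdiff_subset_sdiff_right (hVm m hkl))
      ⟨0, ne_top_of_le_ne_top ((hUε m).trans_le le_top).ne (measure_mono sdiff_subset)⟩
    rwa [← sdiff_iUnion, hVU, sdiff_self, measure_empty] at this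
  have hK : ∀ m k, ∃ K, k ≤ K ∧ (k = 0 → K = 0) ∧ volume (U m \ V m K) ≤ ε (Nat.pair m k) := by
    intro m k
    rcases Nat.eq_zero_or_pos k with rfl | hk
    · exact ⟨0, le_rfl, fun _ => rfl, (measure_mono sdiff_subset).trans (hUε m).le⟩
    · obtain ⟨K, h1, h2⟩ := ((eventually_ge_atTop k).and
        (ENNReal.tendsto_nhds_zero.1 (hlim m) _ (hε (Nat.pair m k)))).exists
      exact ⟨K, h1, fun h => absurd h hk.ne', h2⟩
  choose K hkK hK0 hKε using hK
  refine ⟨fun p => (F p.unpair.1 (K p.unpair.1 (p.unpair.2 + 1)),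
    F p.unpair.1 (K p.unpair.1 p.unpair.2)), fun p => ?_, fun x hx => ?_⟩
  · refine (measure_mono (sdiff_subset_sdiff_left ?_)).trans
      ((hKε p.unpair.1 p.unpair.2).trans_eq (by rw [Nat.pair_unpair]))
    exact (subset_iUnion (V p.unpair.1) _).trans (hVU _).le
  · refine frequently_atTop.2 fun N => ?_
    have hex : ∃ k, x ∈ V N (K N k) := by
      obtain ⟨k, hk⟩ := mem_iUnion.1 ((hVU N).ge (hAU N hx))
      exact ⟨k, hVm N (hkK N k) hk⟩
    have h0 : Nat.find hex ≠ 0 := fun h => by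
      have h1 := Nat.find_spec hex
      rw [h, hK0 N 0 rfl] at h1
      simp [V, F] at h1
    refine ⟨Nat.pair N (Nat.find hex - 1), Nat.left_le_pair _ _, ?_⟩
    simp only [Nat.unpair_pair]
    refine ⟨?_, Nat.find_min hex (by omega)⟩
    rw [Nat.sub_add_cancel (by omega)]
    exact Nat.find_spec hex

theorem locNumber_le_addNull : locNumber ≤ addNull := by
  obtain ⟨b, hb⟩ := exists_nat_basis
  have hf : ∀ A : Set ℝ, ∃ f : ℕ → Finset ℕ × Finset ℕ, volume A = 0 →
      (∀ p, volume (basicDiff b (f p)) ≤ 16⁻¹ ^ p) ∧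
      ∀ x ∈ A, ∃ᶠ p in atTop, x ∈ basicDiff b (f p) := fun A => by
    by_cases hA : volume A = 0
    · obtain ⟨f, hf⟩ := exists_basicDiff hb hA (ε := fun p => 16⁻¹ ^ p)
        (fun p => ENNReal.pow_pos (by simp) p)
      exact ⟨f, fun _ => hf⟩
    · exact ⟨fun _ => (∅, ∅), fun h => absurd h hA⟩
  choose f hf using hf
  rw [addNull_eq]
  refine boundingNumber_le_of_tukey (fun A p => Encodable.encode (f A p))
    (fun S => {x | ∃ᶠ p in atTop, x ∈ captured volume.toOuterMeasure (basicDiff b) S p})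
    (fun _ _ => mem_univ _) (fun S hS => ?_) fun A hA S _ h x hx => ?_
  · exact measure_setOfPred_frequently_eq_zero (ne_top_of_le_ne_top tsum_two_inv_pow_ne_top
      (ENNReal.tsum_le_tsum fun p => captured_le (φ := volume.toOuterMeasure) hS p))
  · refine (((hf A hA).2 x hx).and_eventually h).mono fun p hp => ?_
    exact mem_biUnion (x := f A p) ⟨hp.2, (hf A hA).1 p⟩ hp.1

/-! ### Null sets and the summable ideal -/

/-- The numbers in `[0, 1)` whose digit with weight `1 / (n + 1)!` in the factorial number system
vanishes. -/
def digitZero (n : ℕ) : Set ℝ :=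
  {x | x ∈ Ico (0 : ℝ) 1 ∧ ⌊((n + 1).factorial : ℝ) * x⌋₊ % (n + 1) = 0}

theorem volume_le_of_floor_mem {E : Set ℝ} {N : ℕ} (hN : 0 < N) (J : Finset ℕ)
    (h : ∀ x ∈ E, 0 ≤ x ∧ ⌊(N : ℝ) * x⌋₊ ∈ J) : volume E ≤ ENNReal.ofReal (J.card / N) := by
  have hN' : (0 : ℝ) < N := by exact_mod_cast hN
  have hsub : E ⊆ ⋃ j ∈ J, Ico ((j : ℝ) / N) ((j : ℝ) / N + 1 / N) := fun x hx => by
    obtain ⟨h0, hJ⟩ := h x hx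
    refine mem_biUnion (Finset.mem_coe.2 hJ) ⟨?_, ?_⟩
    · rw [div_le_iff₀ hN', mul_comm x]
      exact Nat.floor_le (by positivity)
    · rw [← add_div, lt_div_iff₀ hN', mul_comm x]
      exact Nat.lt_floor_add_one _
  calc volume E ≤ ∑ j ∈ J, volume (Ico ((j : ℝ) / N) ((j : ℝ) / N + 1 / N)) :=
        (measure_mono hsub).trans (measure_biUnion_finset_le _ _)
    _ = ENNReal.ofReal (J.card / N) := by
        simp only [Real.volume_Ico, add_sub_cancel_left, Finset.sum_const, nsmul_eq_mul]
        rw [div_eq_mul_one_div (J.card : ℝ), ENNReal.ofReal_mul (by positivity),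
          ENNReal.ofReal_natCast]

theorem volume_digitZero_le (n : ℕ) : volume (digitZero n) ≤ ((n : ENNReal) + 1)⁻¹ := by
  have hpos := Nat.factorial_pos (n + 1)
  have hpos' : (0 : ℝ) < (n + 1).factorial := by exact_mod_cast hpos
  refine (volume_le_of_floor_mem hpos ((Finset.range n.factorial).image fun j => (n + 1) * j)
    fun x hx => ⟨hx.1.1, Finset.mem_image.2 ⟨_, ?_,
      Nat.mul_div_cancel' (Nat.dvd_of_mod_eq_zero hx.2)⟩⟩).trans ?_
  · rw [Finset.mem_range, Nat.div_lt_iff_lt_mul (Nat.succ_pos n), mul_comm n.factorial,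
      ← Nat.factorial_succ, Nat.floor_lt (mul_nonneg hpos'.le hx.1.1)]
    exact mul_lt_of_lt_one_right hpos' hx.1.2
  · have h1 : (((Finset.range n.factorial).image fun j => (n + 1) * j).card : ℝ) ≤ n.factorial := by
      exact_mod_cast Finset.card_image_le.trans_eq (Finset.card_range _)
    have h2 : ((n : ENNReal) + 1)⁻¹ = ENNReal.ofReal (((n : ℝ) + 1)⁻¹) := by
      rw [ENNReal.ofReal_inv_of_pos (by positivity), ENNReal.ofReal_add (by positivity) (by simp)]
      simp
    rw [h2]
    refine ENNReal.ofReal_le_ofReal ?_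
    rw [div_le_iff₀ hpos', Nat.factorial_succ]
    push_cast
    rw [inv_mul_cancel_left₀ (by positivity)]
    exact h1

/-- By independence of the digits in the factorial number system, a set on which no digit with index
in `B` vanishes has measure at most `∏ n ∈ B, (1 - 1 / (n + 1)) ≤ exp (-∑ n ∈ B, 1 / (n + 1))`. -/
theorem volume_le_exp_of_disjoint {B : Set ℕ} {E : Set ℝ} (hE : E ⊆ Ico 0 1)
    (h : ∀ n ∈ B, Disjoint E (digitZero n)) (N : ℕ) :
    volume E ≤ ENNReal.ofReal
      (Real.exp (-∑ n ∈ Finset.range N, B.indicator (fun n : ℕ => 1 / ((n : ℝ) + 1)) n)) := by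
  classical
  have key : ∀ N : ℕ, ∃ J : Finset ℕ, (∀ x ∈ E, ⌊(N.factorial : ℝ) * x⌋₊ ∈ J) ∧
      (J.card : ℝ) ≤ N.factorial *
        Real.exp (-∑ n ∈ Finset.range N, B.indicator (fun n : ℕ => 1 / ((n : ℝ) + 1)) n) := by
    intro N
    induction N with
    | zero =>
      refine ⟨{0}, fun x hx => ?_, by simp⟩
      simpa using (hE hx).2
    | succ N ih =>
      obtain ⟨J, hJ, hc⟩ := ih
      let R : Finset ℕ := (Finset.range (N + 1)).filter fun r => N ∈ B → r ≠ 0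
      have hR : (R.card : ℝ) ≤
          (N + 1) * Real.exp (-B.indicator (fun n : ℕ => 1 / ((n : ℝ) + 1)) N) := by
        by_cases hN : N ∈ B
        · have h1 : R.card = N := by
            have : R = (Finset.range (N + 1)).erase 0 := by
              ext r
              simp [R, hN, and_comm]
            rw [this, Finset.card_erase_of_mem (by simp), Finset.card_range, Nat.add_sub_cancel]
          rw [h1, indicator_of_mem hN]
          have h2 := Real.add_one_le_exp (-(1 / ((N : ℝ) + 1)))
          have h3 : ((N : ℝ) + 1) * (-(1 / ((N : ℝ) + 1)) + 1) = N := by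
            field_simp
            ring
          rw [← h3]
          exact (mul_le_mul_of_nonneg_left h2 (by positivity)).trans_eq (by rw [h3])
        · have h1 : R.card ≤ N + 1 := (Finset.card_filter_le _ _).trans_eq (Finset.card_range _)
          rw [indicator_of_notMem hN, neg_zero, Real.exp_zero, mul_one]
          exact_mod_cast h1
      refine ⟨(J ×ˢ R).image fun q => (N + 1) * q.1 + q.2, fun x hx => ?_, ?_⟩
      · refine Finset.mem_image.2 ⟨(⌊((N + 1).factorial : ℝ) * x⌋₊ / (N + 1),
          ⌊((N + 1).factorial : ℝ) * x⌋₊ % (N + 1)), Finset.mem_product.2 ⟨?_, ?_⟩,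
          Nat.div_add_mod _ _⟩
        · have : ⌊((N + 1).factorial : ℝ) * x⌋₊ / (N + 1) = ⌊(N.factorial : ℝ) * x⌋₊ := by
            rw [← Nat.floor_div_natCast, Nat.factorial_succ]
            congr 1
            push_cast
            field_simp
          rw [this]
          exact hJ x hx
        · refine Finset.mem_filter.2 ⟨Finset.mem_range.2 (Nat.mod_lt _ (Nat.succ_pos N)),
            fun hN h0 => ?_⟩
          exact disjoint_left.1 (h N hN) hx ⟨hE hx, h0⟩
      · calc (((J ×ˢ R).image fun q => (N + 1) * q.1 + q.2).card : ℝ) ≤ J.card * R.card := by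
              exact_mod_cast Finset.card_image_le.trans_eq (Finset.card_product J R)
          _ ≤ _ := mul_le_mul hc hR (by positivity) (by positivity)
          _ = _ := by
              rw [Finset.sum_range_succ, neg_add, Real.exp_add, Nat.factorial_succ]
              push_cast
              ring
  obtain ⟨J, hJ, hc⟩ := key N
  have hpos := Nat.factorial_pos N
  refine (volume_le_of_floor_mem hpos J fun x hx => ⟨(hE hx).1, hJ x hx⟩).trans
    (ENNReal.ofReal_le_ofReal ?_)
  rw [div_le_iff₀ (by exact_mod_cast hpos), mul_comm]
  exact hc

theorem mem_summableIdeal_of_disjoint {B : Set ℕ} {E : Set ℝ} (hE : E ⊆ Ico 0 1)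
    (hpos : volume E ≠ 0) (h : ∀ n ∈ B, Disjoint E (digitZero n)) : B ∈ summableIdeal := by
  have hfin : volume E ≠ ⊤ := ne_top_of_le_ne_top (by simp) (measure_mono hE)
  have hv : 0 < (volume E).toReal := ENNReal.toReal_pos hpos hfin
  refine (summable_subtype_iff_indicator (f := fun n : ℕ => 1 / ((n : ℝ) + 1))).2
    (summable_of_sum_range_le (c := -Real.log (volume E).toReal)
      (fun n => indicator_nonneg (fun n _ => by positivity) n) fun N => ?_)
  have h1 := ENNReal.toReal_le_of_le_ofReal (Real.exp_pos _).le (volume_le_exp_of_disjoint hE h N)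
  have h2 := (Real.log_le_iff_le_exp hv).2 h1
  linarith

/-- A null set yields countably many members of the summable ideal as follows. Take a compact set
`K` of positive measure off the null set, all of whose nonempty relatively open subsets have
positive measure. The sets of those `n` for which `O n` misses a given nonempty relatively open
subset of `K` are in the ideal. If the points lying in `O n` for infinitely many `n ∈ A` are all in
the null set, then by the Baire category theorem some nonempty relatively open subset of `K` is
missed by `O n` for almost all `n ∈ A`. -/
theorem exists_summable_of_null {O : ℕ → Set ℝ} (hO : ∀ n, IsOpen (O n))
    (hOG : ∀ n, digitZero n ⊆ O n) {Z : Set ℝ} (hZ : volume Z = 0) :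
    ∃ B : ℕ → Set ℕ, (∀ n, B n ∈ summableIdeal) ∧
      ∀ A : Set ℕ, {x | ∃ᶠ n in atTop, n ∈ A ∧ x ∈ O n} ⊆ Z → ∃ n, A ⊆ B n := by
  classical
  have hI : IsIdeal summableIdeal := by
    rw [summableIdeal_eq]
    exact isIdeal_exh _
  obtain ⟨b, hb⟩ := exists_nat_basis
  have hM : volume (Ico (0 : ℝ) 1 \ toMeasurable volume Z) = 1 := by
    rw [measure_sdiff_null (by rw [measure_toMeasurable, hZ])]
    simp
  obtain ⟨K₀, hK₀, hK₀c, hK₀pos⟩ := (measurableSet_Ico.diff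
    (measurableSet_toMeasurable volume Z)).exists_lt_isCompact (r := 0) (μ := volume)
    (by rw [hM]; exact one_pos)
  -- remove from `K₀` the basic sets whose trace on it is null
  let V : Set ℝ := ⋃ j ∈ {j | volume (K₀ ∩ b j) = 0}, b j
  have hV : volume (K₀ ∩ V) = 0 := by
    simp only [V, inter_iUnion₂]
    exact (measure_biUnion_null_iff (to_countable _)).2 fun j hj => hj
  have hVo : IsOpen V := isOpen_biUnion fun j _ => hb.isOpen ⟨j, rfl⟩
  let K := K₀ \ V
  have hKc : IsCompact K := hK₀c.diff hVo
  have hKb : ∀ j, (K ∩ b j).Nonempty → volume (K ∩ b j) ≠ 0 := by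
    rintro j ⟨x, hx, hxj⟩ h0
    refine hx.2 (mem_biUnion (show volume (K₀ ∩ b j) = 0 from ?_) hxj)
    refine measure_mono_null (fun y hy => ?_) (measure_union_null h0 hV)
    exact (em (y ∈ V)).symm.imp (fun h => ⟨⟨hy.1, h⟩, hy.2⟩) fun h => ⟨hy.1, h⟩
  have hKne : K.Nonempty := by
    refine nonempty_iff_ne_empty.2 fun h => hK₀pos.ne' (measure_mono_null ?_ hV)
    exact fun x hx => ⟨hx, sdiff_eq_empty.1 h hx⟩
  refine ⟨fun p => {n | (K ∩ b p.unpair.1).Nonempty ∧ Disjoint (K ∩ b p.unpair.1) (O n)} ∪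
    Iio p.unpair.2, fun p => hI.union ?_ (hI.finite (finite_Iio _)), fun A hA => ?_⟩
  · by_cases hne : (K ∩ b p.unpair.1).Nonempty
    · exact mem_summableIdeal_of_disjoint
        (fun x hx => (hK₀ hx.1.1).1) (hKb _ hne) fun n hn => hn.2.mono_right (hOG n)
    · simpa [hne] using hI.finite finite_empty
  · have : CompactSpace K := isCompact_iff_compactSpace.1 hKc
    have : Nonempty K := hKne.to_subtype
    let F : ℕ → Set K := fun k => {x | ∀ n, k ≤ n → n ∈ A → x.1 ∉ O n}
    have hF : ∀ k, IsClosed (F k) := fun k => by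
      simp only [F, ofPred_forall]
      refine isClosed_iInter fun n => isClosed_iInter fun _ => isClosed_iInter fun _ => ?_
      exact ((hO n).preimage continuous_subtype_val).isClosed_compl
    have hFu : ⋃ k, F k = univ := eq_univ_of_forall fun x => by
      have hx : ¬ ∃ᶠ n in atTop, n ∈ A ∧ x.1 ∈ O n := fun h =>
        (hK₀ x.2.1).2 (subset_toMeasurable _ _ (hA h))
      obtain ⟨k, hk⟩ := eventually_atTop.1 (not_frequently.1 hx)
      exact mem_iUnion.2 ⟨k, fun n hn hnA hxn => hk n hn ⟨hnA, hxn⟩⟩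
    obtain ⟨k, x, hx⟩ := nonempty_interior_of_iUnion_of_closed hF hFu
    obtain ⟨U, hU, hxU⟩ := mem_interior_iff_mem_nhds.1 hx |> (mem_nhds_subtype K x _).1
    obtain ⟨_, ⟨j, rfl⟩, hxj, hj⟩ := hb.mem_nhds_iff.1 hU
    refine ⟨Nat.pair j k, fun n hn => ?_⟩
    simp only [Nat.unpair_pair]
    refine (lt_or_ge n k).symm.imp (fun hkn => ⟨⟨x, x.2, hxj⟩, ?_⟩) id
    exact disjoint_left.2 fun y hy hyn => hxU (show (⟨y, hy.1⟩ : K) ∈ _ from hj hy.2) n hkn hn hyn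

theorem addNull_le_addOmega_summableIdeal : addNull ≤ addOmega summableIdeal := by
  have hO : ∀ n, ∃ O ⊇ digitZero n, IsOpen O ∧ volume O < 2 * ((n : ENNReal) + 1)⁻¹ := fun n => by
    refine (digitZero n).exists_isOpen_lt_of_lt _ ((volume_digitZero_le n).trans_lt ?_)
    rw [two_mul]
    exact ENNReal.lt_add_right (by simp) (by simp)
  choose O hOG hOo hOv using hO
  choose! B hB hAB using fun (Z : Set ℝ) (hZ : volume Z = 0) => exists_summable_of_null hOo hOG hZ
  rw [addNull_eq, addOmega_eq]
  refine boundingNumber_le_of_tukey (fun A => {x | ∃ᶠ n in atTop, n ∈ A ∧ x ∈ O n}) B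
    (fun A hA => ?_) (fun Z hZ => hB Z hZ) fun A _ Z hZ h => hAB Z hZ A h
  refine measure_setOfPred_frequently_eq_zero (p := fun n x => n ∈ A ∧ x ∈ O n) ?_
  have hA' := mem_summableIdeal_iff.1 hA
  rw [harmonicMeasure_apply, tsum_subtype A fun n : ℕ => ((n : ENNReal) + 1)⁻¹] at hA'
  refine ne_top_of_le_ne_top (ENNReal.mul_ne_top (ENNReal.ofNat_ne_top (n := 2)) hA') ?_
  rw [← ENNReal.tsum_mul_left]
  refine ENNReal.tsum_le_tsum fun n => ?_
  by_cases hn : n ∈ A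
  · simpa [hn] using (hOv n).le
  · simp [hn]

/-! ### The additivity of the null ideal -/

theorem addNull_eq_locNumber : addNull = locNumber := by
  refine (addNull_le_addOmega_summableIdeal.trans ?_).antisymm locNumber_le_addNull
  rw [summableIdeal_eq]
  exact isDyadic_harmonicMeasure.addOmega_le_locNumber

theorem addNull_le_bNumber : addNull ≤ bNumber :=
  addNull_eq_locNumber.trans_le locNumber_le_bNumber

theorem IsDyadic.numbers_eq {φ : OuterMeasure ℕ} (hφ : IsDyadic φ) :
    bSigma (exh φ) = addOmega (exh φ) ∧ addOmega (exh φ) = addNull ∧ bNumber = bS (exh φ) :=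
  ⟨IsIdeal.bSigma_le_addOmega.antisymm
      ((le_min le_rfl hφ.addOmega_le_bNumber).trans (isIdeal_exh φ).min_le_bSigma),
    (hφ.addOmega_le_locNumber.antisymm (locNumber_le_addOmega_exh φ)).trans
      addNull_eq_locNumber.symm,
    (bNumber_le_bS_exh φ).antisymm hφ.bS_le_bNumber⟩

end IdealNumbers

theorem mainTheorem9 :
    (bSigma FIN = bS FIN ∧ bS FIN = bNumber ∧ bNumber < ⊤ ∧ ⊤ = addOmega FIN) ∧
    (bSigma (fubiniEmptyRight FIN) = bS (fubiniEmptyRight FIN) ∧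
      bS (fubiniEmptyRight FIN) = bNumber ∧ bNumber < ⊤ ∧
      ⊤ = addOmega (fubiniEmptyRight FIN)) ∧
    (bSigma densityIdeal = addOmega densityIdeal ∧ addOmega densityIdeal = addNull ∧
      addNull ≤ bNumber ∧ bNumber = bS densityIdeal) ∧
    (bSigma summableIdeal = addOmega summableIdeal ∧ addOmega summableIdeal = addNull ∧
      addNull ≤ bNumber ∧ bNumber = bS summableIdeal) ∧
    (bSigma (fubini FIN FIN) = bS (fubini FIN FIN) ∧
      bS (fubini FIN FIN) = addOmega (fubini FIN FIN) ∧
      addOmega (fubini FIN FIN) = bNumber) ∧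
    (bSigma (fubiniEmptyLeft FIN) = bS (fubiniEmptyLeft FIN) ∧
      bS (fubiniEmptyLeft FIN) = addOmega (fubiniEmptyLeft FIN) ∧
      addOmega (fubiniEmptyLeft FIN) = bNumber) ∧
    (bSigma soleckiIdeal = bS soleckiIdeal ∧ bS soleckiIdeal = addOmega soleckiIdeal ∧
      addOmega soleckiIdeal = ((ℵ₁ : Cardinal.{0}) : WithTop Cardinal.{0})) := by
  have hd : bSigma densityIdeal = addOmega densityIdeal ∧ addOmega densityIdeal = addNull ∧
      bNumber = bS densityIdeal := by
    rw [densityIdeal_eq]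
    exact isDyadic_densitySubmeasure.numbers_eq
  have hs : bSigma summableIdeal = addOmega summableIdeal ∧ addOmega summableIdeal = addNull ∧
      bNumber = bS summableIdeal := by
    rw [summableIdeal_eq]
    exact isDyadic_harmonicMeasure.numbers_eq
  have h1 := isIdeal_FIN.eq_bNumber_of_le (addOmega_FIN ▸ le_top) bS_FIN_le
  have h2 := isIdeal_fubiniEmptyRight.eq_bNumber_of_le (addOmega_fubiniEmptyRight ▸ le_top)
    bS_fubiniEmptyRight_le
  have h5 := isIdeal_fubini.eq_bNumber_of_le bNumber_le_addOmega_fubini bS_fubini_le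
  have h5a : addOmega (fubini FIN FIN) = bNumber :=
    (addOmega_le_bNumber fubiniEmptyLeft_subset_fubini subset_rfl).antisymm
      bNumber_le_addOmega_fubini
  have h6 := isIdeal_fubiniEmptyLeft.eq_bNumber_of_le bNumber_le_addOmega_fubiniEmptyLeft
    bS_fubiniEmptyLeft_le
  have h6a : addOmega (fubiniEmptyLeft FIN) = bNumber :=
    (addOmega_le_bNumber subset_rfl fubiniEmptyLeft_subset_fubini).antisymm
      bNumber_le_addOmega_fubiniEmptyLeft
  have h7 := isIdeal_soleckiIdeal.aleph_one_le_bSigma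
  have h7a := addOmega_soleckiIdeal_le.antisymm isIdeal_soleckiIdeal.aleph_one_le_addOmega
  have h7b := bS_soleckiIdeal_le.antisymm (h7.trans isIdeal_soleckiIdeal.bSigma_le_bS)
  have h7c := (isIdeal_soleckiIdeal.bSigma_le_bS.trans bS_soleckiIdeal_le).antisymm h7
  exact ⟨⟨h1.1.trans h1.2.symm, h1.2, bNumber_lt_top, addOmega_FIN.symm⟩,
    ⟨h2.1.trans h2.2.symm, h2.2, bNumber_lt_top, addOmega_fubiniEmptyRight.symm⟩,
    ⟨hd.1, hd.2.1, addNull_le_bNumber, hd.2.2⟩, ⟨hs.1, hs.2.1, addNull_le_bNumber, hs.2.2⟩,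
    ⟨h5.1.trans h5.2.symm, h5.2.trans h5a.symm, h5a⟩,
    ⟨h6.1.trans h6.2.symm, h6.2.trans h6a.symm, h6a⟩, h7c.trans h7b.symm, h7b.trans h7a.symm, h7a⟩
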